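/- Let $\mathbb{Q}$ be a smooth $D$-dimensional manifold (Hausdorff, $\sigma$-compact, without boundary), $\mathbb{P}_L=T\mathbb{Q}$, $\mathbb{P}_C=T^*\mathbb{Q}$, and let $L:\mathbb{P}_L\to\mathbb{R}$ be a smooth Lagrangian with fibre derivative $\mathcal{L}:\mathbb{P}_L\to\mathbb{P}_C$, $(q,v)\mapsto(q,\partial L/\partial v)$. Put $\theta_L=\frac{\partial L}{\partial v^a}dq^a$, $\Omega_L=-d\theta_L$, $E=v^a\frac{\partial L}{\partial v^a}-L$, $M_{ab}=\frac{\partial^2L}{\partial v^a\partial v^b}$, $F_{ab}=\frac{\partial^2L}{\partial v^a\partial q^b}-\frac{\partial^2L}{\partial v^b\partial q^a}$, $\omega=dq^a\wedge dp_a$. Assume that $L$ is almost regular: $\dim\ker M(\mathfrak u)=N_0$ for all $\mathfrak u$, the image $\mathcal{L}(\mathbb{P}_L)$ is an embedded submanifold of $\mathbb{P}_C$, $\mathcal{L}$ is a submersion onto $\mathcal{L}(\mathbb{P}_L)$, and the sets $\mathcal{L}^{-1}(\mathcal{L}(\mathfrak u))$ are connected. All vector fields on $\mathbb{P}_L$ below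 are smooth and globally defined. Let $\mathcal{G}$ be the set of vertical vector fields $\mathbf{G}$ with $i_{\mathbf G}\Omega_L=0$; let $\overline{T\mathbb{P}_L}=\{\mathbf X: [\mathbf X,\mathbf G]\in\mathcal{G}\ \forall\,\mathbf G\in\mathcal{G}\}$, let $\overline{T\mathbb{P}_L}/\mathcal{G}$ be its quotient by the relation $\mathbf X_1-\mathbf X_2\in\mathcal{G}$, and let $\overline{\ker\Omega_L}=\{\mathbf P: i_{\mathbf P}\Omega_L=0,\ [\mathbf G,\mathbf P]\text{ vertical }\forall\,\mathbf G\in\mathcal{G}\}$. A vector field $\mathbf X$ is projectable if $\mathcal{L}_*\mathbf X(\mathfrak u)$ depends only on $\mathcal{L}(\mathfrak u)$. Let $\mathbb{P}_L^{[1]}$ be the set of $\mathfrak u=(q,v)$ with $z^a\left(\frac{\partial E}{\partial q^a}+F_{ab}v^b\right)=0$ for all $z\in\ker M(\mathfrak u)$. A SOELVF is a vector field $\mathbf X$ with $i_{\mathbf X}\Omega_L=dE$ on $\mathbb{P}_L^{[1]}$ and $[\mathbf G,\mathbf X]$ vertical for all $\mathbf G\in\mathcal{G}$. A system of primary constraints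 on an open set $V\subseteq\mathbb{P}_C$ consists of $N_0$ smooth functions $\gamma^{[0]}_1,\dots,\gamma^{[0]}_{N_0}$ on $V$ which vanish on $V\cap\mathcal{L}(\mathbb{P}_L)$ and whose differentials are linearly independent at the points of $V\cap\mathcal{L}(\mathbb{P}_L)$. It defines, in $V$, the primary constraint submanifold $\mathbb{P}_C^{[0]}=\{\gamma^{[0]}_n=0,\ n=1,\dots,N_0\}$, with tangent space $T_{\mathfrak s}\mathbb{P}_C^{[0]}=\bigcap_n\ker d\gamma^{[0]}_n(\mathfrak s)$ at $\mathfrak s\in V\cap\mathcal{L}(\mathbb{P}_L)$. Then: 1. For each $\mathfrak u\in\mathbb{P}_L$ all representatives of a class in $\overline{T\mathbb{P}_L}/\mathcal{G}$ have the same pushforward $\mathcal{L}_*\mathbf X(\mathfrak u)$, and there is a system of primary constraints on a neighbourhood of $\mathcal{L}(\mathfrak u)$. 2. For every system of primary constraints on $V$ and every $\mathfrak u$ with $\mathcal{L}(\mathfrak u)\in V$, $$\mathcal{L}_*\big(\overline{T_{\mathfrak u}\mathbb{P}_L}/\mathcal{G}\big)=T_{\mathcal{L}(\mathfrak u)}\mathbb{P}_C^{[0]},$$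 where the left side is the set of the pushforwards at $\mathfrak u$ of all classes. 3. If $\dim\ker\Omega_L(\mathfrak u)=2N_0$ for all $\mathfrak u$, then for every system of primary constraints on $V$ and every $\mathfrak u$ with $\mathcal{L}(\mathfrak u)\in V$ the span of the $d\gamma_n^{[0]}(\mathcal{L}(\mathfrak u))$ is $\mathrm{Prim}^\flat=\{i_{\mathcal{L}_*\mathbf P(\mathfrak u)}\,\omega:\mathbf P\in\overline{\ker\Omega_L}\}$; that is, the $\gamma^{[0]}_n$ are first integrals of the Pfaff system $\mathrm{Prim}^\flat=0$. 4. Every projectable vector field on $\mathbb{P}_L$ belongs to $\overline{T\mathbb{P}_L}$. 5. Let $\mathbf X$ be a SOELVF and let $\mathbb{P}_C^{[0]}$ be given by a system of primary constraints on $V$. (a) $\mathcal{L}_*\mathbf X(\mathfrak u)\in T_{\mathcal{L}(\mathfrak u)}\mathbb{P}_C^{[0]}$ whenever $\mathcal{L}(\mathfrak u)\in V$. (b) If $\mathfrak u(t)$ is an integral curve of $\mathbf X$ on an open interval, then $\mathcal{L}(\mathfrak u(t))\in\mathbb{P}_C^{[0]}$ whenever $\mathcal{L}(\mathfrak u(t))\in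 V$. (c) If $\mathcal{L}(\mathfrak u_0)\in V$ and $\mathbf Y$ is a vector field on $\mathbb{P}_C$, of class $C^1$ near $\mathcal{L}(\mathfrak u_0)$, with $\mathbf Y(\mathcal{L}(\mathfrak u))=\mathcal{L}_*\mathbf X(\mathfrak u)$ for $\mathfrak u$ near $\mathfrak u_0$, then every integral curve of $\mathbf Y$ with $\mathfrak s(t_0)=\mathcal{L}(\mathfrak u_0)$ stays on $\mathbb{P}_C^{[0]}$ for $t$ near $t_0$. -/

import Mathlib

open Set Filter
open scoped Manifold Topology ContDiff Bundle

noncomputable section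

namespace SingularLagrangian

/-! ### Exterior derivative of a one-form on a manifold -/

section OneForms

variable {F : Type*} [NormedAddCommGroup F] [NormedSpace ℝ F]
  {H : Type*} [TopologicalSpace H] (I : ModelWithCorners ℝ F H)
  {M : Type*} [TopologicalSpace M] [ChartedSpace H M]

/-- The coordinate expression, in the preferred chart at `x`, of a one-form `θ` on `M`. -/
def oneFormInChart (θ : ∀ x : M, TangentSpace I x →L[ℝ] ℝ) (x : M) : F → (F →L[ℝ] ℝ) :=
  fun y => (θ ((extChartAt I x).symm y)).comp
    (mfderiv 𝓘(ℝ, F) I (extChartAt I x).symm y : F →L[ℝ] TangentSpace I ((extChartAt I x).symm y))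

/-- The differential at `x` of the preferred chart at `x`. -/
def dChart (x : M) : TangentSpace I x →L[ℝ] F :=
  mfderiv I 𝓘(ℝ, F) (extChartAt I x) x

/-- The exterior derivative `(dθ)_x(ξ, η) = D_ξ θ (η) - D_η θ (ξ)` of a one-form on a manifold
without boundary, computed in the preferred chart at `x`. -/
def extD (θ : ∀ x : M, TangentSpace I x →L[ℝ] ℝ) (x : M) (ξ η : TangentSpace I x) : ℝ :=
  fderiv ℝ (oneFormInChart I θ x) (extChartAt I x x) (dChart I x ξ) (dChart I x η) -
    fderiv ℝ (oneFormInChart I θ x) (extChartAt I x x) (dChart I x η) (dChart I x ξ)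

lemma extD_add_left (θ : ∀ x : M, TangentSpace I x →L[ℝ] ℝ) (x : M)
    (ξ ξ' η : TangentSpace I x) :
    extD I θ x (ξ + ξ') η = extD I θ x ξ η + extD I θ x ξ' η := by
  simp only [extD, map_add, add_apply]
  ring

lemma extD_smul_left (θ : ∀ x : M, TangentSpace I x →L[ℝ] ℝ) (x : M) (c : ℝ)
    (ξ η : TangentSpace I x) :
    extD I θ x (c • ξ) η = c * extD I θ x ξ η := by
  simp only [extD, map_smul, smul_apply, smul_eq_mul]
  ring

end OneForms

variable {E : Type*} [NormedAddCommGroup E] [NormedSpace ℝ E]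
  {Q : Type*} [TopologicalSpace Q] [ChartedSpace E Q] [IsManifold 𝓘(ℝ, E) ∞ Q]

/-! ### The two phase spaces -/

variable (E Q) in
/-- The Lagrangian phase space `P_L = TQ`. -/
abbrev PL := TangentBundle 𝓘(ℝ, E) Q

variable (E) in
/-- The model with corners of `P_L = TQ`. -/
abbrev IL : ModelWithCorners ℝ (E × E) (ModelProd E E) := 𝓘(ℝ, E).tangent

variable (E Q) in
/-- The canonical phase space `P_C = T^*Q`: the total space of the bundle of linear forms on the
tangent spaces of `Q`. -/
abbrev PC := Bundle.TotalSpace (E →L[ℝ] ℝ)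
  (fun q : Q => TangentSpace 𝓘(ℝ, E) q →L[ℝ] Bundle.Trivial Q ℝ q)

variable (E) in
/-- The model with corners of `P_C = T^*Q`. -/
abbrev IC : ModelWithCorners ℝ (E × (E →L[ℝ] ℝ)) (ModelProd E (E →L[ℝ] ℝ)) :=
  𝓘(ℝ, E).prod 𝓘(ℝ, E →L[ℝ] ℝ)

/-- The tangent map `Tτ_Q` of the projection `τ_Q : TQ → Q` at `u`. -/
def dTau (u : PL E Q) : TangentSpace (IL E) u →L[ℝ] TangentSpace 𝓘(ℝ, E) u.proj :=
  mfderiv (IL E) 𝓘(ℝ, E) (fun w : PL E Q => w.proj) u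

/-- The differential of a real function on `T^*Q`. -/
def dC (g : PC E Q → ℝ) (s : PC E Q) : TangentSpace (IC E) s →L[ℝ] ℝ :=
  mfderiv (IC E) 𝓘(ℝ, ℝ) g s

/-- The canonical one-form `p_a dq^a` on `T^*Q`. -/
def canonicalOneForm (s : PC E Q) : TangentSpace (IC E) s →L[ℝ] ℝ :=
  (show E →L[ℝ] ℝ from s.snd).comp
    (mfderiv (IC E) 𝓘(ℝ, E) (fun r : PC E Q => r.proj) s : TangentSpace (IC E) s →L[ℝ] E)

/-- The canonical two-form `ω = dq^a ∧ dp_a = -d(p_a dq^a)` on `T^*Q`. -/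
def canonicalForm (s : PC E Q) (ξ η : TangentSpace (IC E) s) : ℝ :=
  -extD (IC E) canonicalOneForm s ξ η

/-! ### Lagrangian, fibre derivative, Hessian, Lagrange two-form, energy -/

/-- The derivative at `v ∈ T_qQ` of the restriction of `L` to the fibre `T_qQ`. -/
def fibreDeriv (L : PL E Q → ℝ) (q : Q) (v : E) : E →L[ℝ] ℝ :=
  fderiv ℝ (fun w : E => L ⟨q, w⟩) v

/-- The Hessian `M_{ab} = ∂²L/∂v^a∂v^b` of `L` along the fibre of `TQ`. -/
def hessian (L : PL E Q → ℝ) (u : PL E Q) : E →L[ℝ] E →L[ℝ] ℝ :=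
  fderiv ℝ (fibreDeriv L u.proj) u.snd

/-- The fibre derivative (Legendre map) `TQ → T^*Q`, `(q, v) ↦ (q, ∂L/∂v)`. -/
def legendre (L : PL E Q → ℝ) (u : PL E Q) : PC E Q :=
  ⟨u.proj, (show E →L[ℝ] ℝ from fibreDeriv L u.proj u.snd)⟩

/-- The pushforward `T_u P_L → T_{ℒ(u)} P_C` of the fibre derivative at a point. -/
def dLegendre (L : PL E Q → ℝ) (u : PL E Q) :
    TangentSpace (IL E) u →L[ℝ] TangentSpace (IC E) (legendre L u) :=
  mfderiv (IL E) (IC E) (legendre L) u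

/-- The one-form `θ_L = (∂L/∂v^a) dq^a` on `TQ`. -/
def thetaL (L : PL E Q → ℝ) (u : PL E Q) : TangentSpace (IL E) u →L[ℝ] ℝ :=
  (fibreDeriv L u.proj u.snd).comp (show TangentSpace (IL E) u →L[ℝ] E from dTau u)

/-- The Lagrange two-form `Ω_L = -dθ_L`. -/
def omegaL (L : PL E Q → ℝ) (u : PL E Q) (ξ η : TangentSpace (IL E) u) : ℝ :=
  -extD (IL E) (thetaL L) u ξ η

/-- The kernel of `Ω_L` at the point `u`. -/
def kerOmegaAt (L : PL E Q → ℝ) (u : PL E Q) : Submodule ℝ (TangentSpace (IL E) u) where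
  carrier := {ξ | ∀ η, omegaL L u ξ η = 0}
  zero_mem' := fun η => by
    have h := extD_smul_left (IL E) (thetaL L) u 0 0 η
    simp only [zero_smul, zero_mul] at h
    simp [omegaL, h]
  add_mem' := fun {a b} ha hb η => by
    have h1 := ha η
    have h2 := hb η
    simp only [omegaL, extD_add_left] at h1 h2 ⊢
    linarith
  smul_mem' := fun c a ha η => by
    have h1 := ha η
    simp only [omegaL, extD_smul_left] at h1 ⊢
    linear_combination c * h1

/-- The energy `v^a ∂L/∂v^a - L`. -/
def energy (L : PL E Q → ℝ) (u : PL E Q) : ℝ :=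
  fibreDeriv L u.proj u.snd (show E from u.snd) - L u

/-- The differential of the energy. -/
def dEnergy (L : PL E Q → ℝ) (u : PL E Q) : TangentSpace (IL E) u →L[ℝ] ℝ :=
  mfderiv (IL E) 𝓘(ℝ, ℝ) (energy L) u

/-! ### Almost regular Lagrangians -/

/-- `L` is a smooth almost regular Lagrangian whose Hessian has nullity `N₀` everywhere: the image
of the fibre derivative is an embedded submanifold of `T^*Q` (in suitable charts `φ` of the smooth
atlas it is cut out by a linear subspace `S` of the model space), the fibre derivative is a
submersion onto that image (the range of its differential is the tangent space of the image), and
its nonempty fibres are connected. -/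
structure IsAlmostRegular (L : PL E Q → ℝ) (N₀ : ℕ) : Prop where
  smooth : ContMDiff (IL E) 𝓘(ℝ, ℝ) ∞ L
  nullity : ∀ u, Module.finrank ℝ (LinearMap.ker (hessian L u : E →ₗ[ℝ] E →L[ℝ] ℝ)) = N₀
  submersion_onto_image : ∀ u : PL E Q,
    ∃ φ ∈ IsManifold.maximalAtlas (IC E) ∞ (PC E Q), legendre L u ∈ φ.source ∧
      ∃ S : Submodule ℝ (E × (E →L[ℝ] ℝ)),
        (∀ s ∈ φ.source, s ∈ range (legendre L) ↔ φ.extend (IC E) s ∈ S) ∧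
        ∀ ξ : TangentSpace (IC E) (legendre L u),
          ξ ∈ range (dLegendre L u) ↔
            (mfderiv (IC E) 𝓘(ℝ, E × (E →L[ℝ] ℝ)) (φ.extend (IC E)) (legendre L u) ξ :
              E × (E →L[ℝ] ℝ)) ∈ S
  connected_fibres : ∀ u, IsConnected (legendre L ⁻¹' {legendre L u})

/-! ### Spaces of vector fields on `P_L` -/

variable (E Q) in
/-- Vector fields on `P_L`, without any regularity. -/
abbrev Field := ∀ u : PL E Q, TangentSpace (IL E) u

/-- Smoothness of a vector field on `P_L`. -/
def IsSmooth (X : Field E Q) : Prop :=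
  ContMDiff (IL E) (IL E).tangent ∞ (fun u => (⟨u, X u⟩ : TangentBundle (IL E) (PL E Q)))

lemma IsSmooth.mdiff {X : Field E Q} (hX : IsSmooth X) (u : PL E Q) :
    MDifferentiableAt (IL E) (IL E).tangent
      (fun u => (⟨u, X u⟩ : TangentBundle (IL E) (PL E Q))) u :=
  hX.mdifferentiable (by simp) u

/-- Vertical vector fields. -/
def IsVertical (X : Field E Q) : Prop := ∀ u, dTau u (X u) = 0

/-- The Lie bracket of vector fields on `P_L`. -/
def bracket (X Y : Field E Q) : Field E Q := VectorField.mlieBracket (IL E) X Y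

variable (E Q) in
/-- The space of smooth vector fields on `P_L`. -/
def smoothFields : Submodule ℝ (Field E Q) where
  carrier := {X | IsSmooth X}
  zero_mem' := Bundle.contMDiff_zeroSection ℝ (TangentSpace (IL E) : PL E Q → Type _)
  add_mem' := fun hX hY => ContMDiff.add_section hX hY
  smul_mem' := fun _ _ hX => ContMDiff.const_smul_section hX

/-- `𝒢`: the smooth vertical vector fields `G` with `i_G Ω_L = 0`. In coordinates these are the
fields `z^a ∂/∂v^a` with `M_{ab} z^b = 0`. -/
def vertKer (L : PL E Q → ℝ) : Submodule ℝ (Field E Q) where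
  carrier := {G | IsSmooth G ∧ IsVertical G ∧ ∀ u, G u ∈ kerOmegaAt L u}
  zero_mem' := ⟨(smoothFields E Q).zero_mem, fun u => map_zero _, fun u => zero_mem _⟩
  add_mem' := fun hX hY => ⟨(smoothFields E Q).add_mem hX.1 hY.1,
    fun u => by
      have h1 := hX.2.1 u
      have h2 := hY.2.1 u
      simp [h1, h2], fun u => add_mem (hX.2.2 u) (hY.2.2 u)⟩
  smul_mem' := fun c _ hX => ⟨(smoothFields E Q).smul_mem c hX.1,
    fun u => by
      have h1 := hX.2.1 u
      simp [h1], fun u => Submodule.smul_mem _ c (hX.2.2 u)⟩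

variable [FiniteDimensional ℝ E]

/-- `\overline{T P_L}`: the smooth vector fields `X` on `P_L` with `[X, G] ∈ 𝒢` for all `G ∈ 𝒢`. -/
def barT (L : PL E Q → ℝ) : Submodule ℝ (Field E Q) where
  carrier := {X | IsSmooth X ∧ ∀ G ∈ vertKer L, bracket X G ∈ vertKer L}
  zero_mem' := ⟨(smoothFields E Q).zero_mem, fun G _ => by
    simp only [bracket, VectorField.mlieBracket_zero_left]; exact zero_mem _⟩
  add_mem' := fun {X Y} hX hY => ⟨(smoothFields E Q).add_mem hX.1 hY.1, fun G hG => by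
    have h : bracket (X + Y) G = bracket X G + bracket Y G := by
      have : CompleteSpace E := FiniteDimensional.complete ℝ E
      funext u
      exact VectorField.mlieBracket_add_left (IsSmooth.mdiff hX.1 u) (IsSmooth.mdiff hY.1 u)
    rw [h]
    exact add_mem (hX.2 G hG) (hY.2 G hG)⟩
  smul_mem' := fun c X hX => ⟨(smoothFields E Q).smul_mem c hX.1, fun G hG => by
    have h : bracket (c • X) G = c • bracket X G := by
      have : CompleteSpace E := FiniteDimensional.complete ℝ E
      funext u
      exact VectorField.mlieBracket_const_smul_left (IsSmooth.mdiff hX.1 u)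
    rw [h]
    exact Submodule.smul_mem _ c (hX.2 G hG)⟩

/-- The quotient `\overline{T P_L}/𝒢`: two fields are equivalent iff their difference is in `𝒢`. -/
abbrev BarTQuot (L : PL E Q → ℝ) := barT L ⧸ (vertKer L).submoduleOf (barT L)

/-- The pushforward at `u` of a class in `\overline{T P_L}/𝒢`, as the collection of the
pushforwards of its representatives. -/
def pushClass (L : PL E Q → ℝ) (u : PL E Q) (c : BarTQuot L) :
    Set (TangentSpace (IC E) (legendre L u)) :=
  {ξ | ∃ X : barT L, Submodule.Quotient.mk X = c ∧ dLegendre L u (X.1 u) = ξ}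

/-- A vector field on `P_L` is projectable if its pushforward by the fibre derivative takes a
single value on each preimage of a point of `P_C`. -/
def IsProjectable (L : PL E Q → ℝ) (X : Field E Q) : Prop :=
  ∀ u u' : PL E Q, legendre L u = legendre L u' →
    (⟨legendre L u, dLegendre L u (X u)⟩ : TangentBundle (IC E) (PC E Q)) =
      ⟨legendre L u', dLegendre L u' (X u')⟩

/-- `\overline{ker Ω_L}`: the smooth fields `P` in the kernel of `Ω_L` such that `[G, P]` is
vertical for all `G ∈ 𝒢`. -/
def barKer (L : PL E Q → ℝ) : Set (Field E Q) :=
  {P | IsSmooth P ∧ (∀ u, P u ∈ kerOmegaAt L u) ∧ ∀ G ∈ vertKer L, IsVertical (bracket G P)}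

/-- `Prim = ℒ_*(\overline{ker Ω_L})` at the point `ℒ(u)`. -/
def prim (L : PL E Q → ℝ) (u : PL E Q) : Set (TangentSpace (IC E) (legendre L u)) :=
  {ξ | ∃ P ∈ barKer L, dLegendre L u (P u) = ξ}

/-- `Prim^♭`: the covectors `i_ξ ω`, `ξ ∈ Prim`, at the point `ℒ(u)`. -/
def primFlat (L : PL E Q → ℝ) (u : PL E Q) : Set (TangentSpace (IC E) (legendre L u) →L[ℝ] ℝ) :=
  {σ | ∃ ξ ∈ prim L u, ∀ η, σ η = canonicalForm (legendre L u) ξ η}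

/-! ### The first-order Lagrangian constraint set and the SOELVFs -/

/-- The first-order constraint set `P_L^{[1]}`: the points where the one-form `dE - i_X Ω_L`, with
`X` second order, vanishes on all vectors whose projection to `TQ` lies in the kernel of the
Hessian. -/
def firstConstraintSet (L : PL E Q → ℝ) : Set (PL E Q) :=
  {u | ∀ ξ c : TangentSpace (IL E) u, dTau u ξ = u.snd → hessian L u (dTau u c) = 0 →
    dEnergy L u c - omegaL L u ξ c = 0}

/-- Second-order Euler-Lagrange vector fields: smooth solutions `X` of the energy equation
`i_X Ω_L = dE` on `P_L^{[1]}` such that `[G, X]` is vertical for all `G ∈ 𝒢`. -/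
def IsSOELVF (L : PL E Q → ℝ) (X : Field E Q) : Prop :=
  IsSmooth X ∧
  (∀ u ∈ firstConstraintSet L, ∀ η, omegaL L u (X u) η = dEnergy L u η) ∧
  ∀ G ∈ vertKer L, IsVertical (bracket G X)

/-! ### Primary constraints -/

/-- `γ_1, …, γ_{N₀}` is a system of primary Hamiltonian constraints on the open set `V ⊆ T^*Q`:
smooth functions vanishing on `ℒ(P_L) ∩ V`, with independent differentials there. -/
structure IsPrimaryConstraints (L : PL E Q → ℝ) {N₀ : ℕ} (V : Set (PC E Q))
    (γ : Fin N₀ → PC E Q → ℝ) : Prop where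
  isOpen : IsOpen V
  smooth : ∀ n, ContMDiffOn (IC E) 𝓘(ℝ, ℝ) ∞ (γ n) V
  vanish : ∀ n, ∀ s ∈ range (legendre L) ∩ V, γ n s = 0
  independent : ∀ s ∈ range (legendre L) ∩ V, LinearIndependent ℝ (fun n => dC (γ n) s)

/-- The primary constraint submanifold `P_C^{[0]}` cut out by `γ` in `V`. -/
def primarySubmanifold {N₀ : ℕ} (V : Set (PC E Q)) (γ : Fin N₀ → PC E Q → ℝ) : Set (PC E Q) :=
  {s | s ∈ V ∧ ∀ n, γ n s = 0}

/-- The tangent space at `s` of the level set cut out by functions `γ_n` with independent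
differentials at `s`. -/
def primaryTangent {N₀ : ℕ} (γ : Fin N₀ → PC E Q → ℝ) (s : PC E Q) :
    Set (TangentSpace (IC E) s) :=
  {ξ | ∀ n, dC (γ n) s ξ = 0}

end SingularLagrangian

end

open Set Filter
open scoped Manifold Topology ContDiff Bundle

set_option linter.unusedSectionVars false

noncomputable section

/-! In charts the fibre derivative is `(q, v) ↦ (q, p)` with `p = ∂L/∂v`, so its differential sends
`(a, w)` to `(a, D_q p a + M w)` (`dChC_dLegendre`), and `Ω_L` is the pullback of `ω` (`omegaL_eq`).
Hence the kernel of the pushforward is a copy of `ker M` and consists of the vertical vectors in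
`ker Ω_L`. So `𝒢` is the space of smooth fields killed by the pushforward (`mem_vertKer_iff`), which
makes pushforwards of classes well defined. The range has codimension `N₀`; the constraints vanish
on the image, so a dimension count identifies the range with the common kernel of the `dγ_n`
(`mem_range_dLegendre_iff`).

Projectable fields lie in `barT` (`IsProjectable.mem_barT`): with `f` the fibre derivative read in a
chart of `T^*Q`, both `X (G f)` and `G (X f)` vanish, the first because `G f = 0`, the second
because `X f` is constant along the flow of `G`, which stays in the fibres. Thus `[X, G] f = 0`.

The surjectivity statements therefore reduce to constructing projectable fields. A vector field near
`ℒ(u₀)` that is tangent to the image is lifted by solving `M w = c` and then cut off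
(`exists_lift`). The cutoff is a bump function on `T^*Q` composed with `ℒ`, whose support contains
whole pieces of fibres, so a lift defined only near `u₀` would not do. Constant rank and symmetry of
`M` give a distinguished solution, smooth on all of the relevant open set
(`exists_contDiffOn_solution_of_symmetric`).

For tangent vectors, the field to lift is a local field tangent to all level sets of the
constraints. For `Prim^♭` it is the Hamiltonian field of a constant-coefficient combination of
constraints. When `dim ker Ω_L = 2 N₀`, the pushforward of `ker Ω_L` has dimension `N₀`, and `ω`
identifies it with the span of the `dγ_n` (`exists_mem_kerOmegaAt`); this makes the Hamiltonian
fields tangent to the image.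

The claims on flows follow from the chain rule and from local uniqueness of integral curves. -/

namespace SingularLagrangian

/-! ### Smooth solutions of constant-rank linear systems; inversion of the canonical pairing. -/

section LinearAlgebra

variable {X E F G : Type*} [NormedAddCommGroup X] [NormedSpace ℝ X]
  [NormedAddCommGroup E] [NormedSpace ℝ E] [NormedAddCommGroup F] [NormedSpace ℝ F]
  [NormedAddCommGroup G] [NormedSpace ℝ G]

/-- Fix a complement `K` of `ker (A x₀)` and a left inverse `T` of `A x₀` on `K`. Then `T ∘ A x`
restricted to `K` is the identity at `x₀`, hence invertible nearby, and its inverse applied to `T (c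
x)` is a smooth solution. -/
lemma exists_contDiffAt_solution [FiniteDimensional ℝ E] [FiniteDimensional ℝ F]
    {A : X → E →L[ℝ] F} {c : X → F} {x₀ : X}
    (hA : ContDiffAt ℝ ∞ A x₀) (hc : ContDiffAt ℝ ∞ c x₀)
    (hrank : ∀ᶠ x in 𝓝 x₀, Module.finrank ℝ (LinearMap.ker (A x : E →ₗ[ℝ] F)) =
      Module.finrank ℝ (LinearMap.ker (A x₀ : E →ₗ[ℝ] F)))
    (hr : ∀ᶠ x in 𝓝 x₀, c x ∈ range (A x)) :
    ∃ w : X → E, ContDiffAt ℝ ∞ w x₀ ∧ ∀ᶠ x in 𝓝 x₀, A x (w x) = c x := by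
  obtain ⟨K, hK⟩ := Submodule.exists_isCompl (LinearMap.ker (A x₀ : E →ₗ[ℝ] F))
  have hinj : LinearMap.ker ((A x₀ : E →ₗ[ℝ] F) ∘ₗ K.subtype) = ⊥ := by
    rw [LinearMap.ker_eq_bot']
    intro k hk
    have h1 : (k : E) ∈ LinearMap.ker (A x₀ : E →ₗ[ℝ] F) ⊓ K := ⟨hk, k.2⟩
    rw [hK.inf_eq_bot] at h1
    exact Subtype.ext h1
  obtain ⟨T', hT'⟩ := LinearMap.exists_leftInverse_of_injective _ hinj
  set T : F →L[ℝ] K := LinearMap.toContinuousLinearMap T' with hT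
  set B : X → K →L[ℝ] K := fun x => (T.comp (A x)).comp K.subtypeL with hB
  have hB0 : B x₀ = ContinuousLinearMap.id ℝ K := by
    ext k
    have := congrArg (fun f => f k) hT'
    simpa [hB, hT] using congrArg Subtype.val this
  have hBd : ContDiffAt ℝ ∞ B x₀ :=
    ContDiffAt.clm_comp (contDiffAt_const.clm_comp hA) contDiffAt_const
  have : CompleteSpace K := FiniteDimensional.complete ℝ K
  have hinv : ContDiffAt ℝ ∞ (fun x => ContinuousLinearMap.inverse (B x)) x₀ := by
    have h := contDiffAt_map_inverse (𝕜 := ℝ) (n := ∞) (ContinuousLinearEquiv.refl ℝ K)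
    refine ContDiffAt.comp x₀ (g := ContinuousLinearMap.inverse) ?_ hBd
    rw [hB0]
    exact h
  have hunit : ∀ᶠ x in 𝓝 x₀, ∃ e : K ≃L[ℝ] K, (e : K →L[ℝ] K) = B x := by
    have h := (ContinuousLinearEquiv.refl ℝ K).nhds
    have h' : range ((↑) : (K ≃L[ℝ] K) → K →L[ℝ] K) ∈ 𝓝 (B x₀) := by
      rw [hB0]; exact h
    exact hBd.continuousAt.preimage_mem_nhds h'
  refine ⟨fun x => K.subtypeL (ContinuousLinearMap.inverse (B x) (T (c x))), ?_, ?_⟩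
  · exact contDiffAt_const.clm_apply (hinv.clm_apply (contDiffAt_const.clm_apply hc))
  · filter_upwards [hrank, hr, hunit] with x h1 h2 ⟨e, he⟩
    set φ := ((A x : E →ₗ[ℝ] F) ∘ₗ K.subtype) with hφ
    have hφinj : Function.Injective φ := by
      intro a b hab
      apply e.injective
      have : e a = (e : K →L[ℝ] K) a := rfl
      have h3 : e b = (e : K →L[ℝ] K) b := rfl
      rw [this, h3, he]
      exact congrArg T hab
    -- Constancy of the rank enters here: `A x` is injective on `K`, and `dim K` is the rank of `A
    -- x`, so `K` alone already fills the range.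
    have hrange : LinearMap.range φ = LinearMap.range (A x : E →ₗ[ℝ] F) := by
      apply Submodule.eq_of_le_of_finrank_eq
      · exact LinearMap.range_comp_le_range _ _
      · have h4 := LinearMap.finrank_range_add_finrank_ker (A x : E →ₗ[ℝ] F)
        have h5 := Submodule.finrank_add_eq_of_isCompl hK
        rw [LinearMap.finrank_range_of_inj hφinj]
        omega
    obtain ⟨k, hk⟩ : c x ∈ LinearMap.range φ := by
      rw [hrange]; exact h2
    have h6 : T (c x) = e k := by
      rw [← hk]
      have : e k = (e : K →L[ℝ] K) k := rfl
      rw [this, he]; rfl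
    rw [h6, ← he, ContinuousLinearMap.inverse_equiv]
    simpa using! hk

/-- `J` is the Euclidean structure on the dual attached to a basis: `φ (J φ)` is the sum of the
squares of the coordinates of `φ`. -/
lemma exists_symmetric_pos_dual [FiniteDimensional ℝ E] :
    ∃ J : (E →L[ℝ] ℝ) →L[ℝ] E, ∀ φ : E →L[ℝ] ℝ, φ (J φ) = 0 → φ = 0 := by
  let b := Module.finBasis ℝ E
  let J : (E →L[ℝ] ℝ) →ₗ[ℝ] E :=
    { toFun := fun φ => ∑ i, φ (b i) • b i
      map_add' := fun φ ψ => by simp [add_smul, Finset.sum_add_distrib]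
      map_smul' := fun a φ => by simp [Finset.smul_sum, mul_smul] }
  refine ⟨LinearMap.toContinuousLinearMap J, fun φ h => ?_⟩
  have h1 : ∑ i, φ (b i) * φ (b i) = 0 := by
    simpa [J, map_sum] using h
  rw [Finset.sum_eq_zero_iff_of_nonneg (fun i _ => mul_self_nonneg _)] at h1
  have h2 : (φ : E →ₗ[ℝ] ℝ) = 0 := b.ext fun i => by simpa using h1 i (Finset.mem_univ i)
  ext x
  exact congrArg (fun f => f x) h2

/-- Local smooth solutions of `M w = c` need not agree, so a distinguished one is used: `w = J (M
z)` with `M J M z = c`. By symmetry and positivity of `J`, `M J M` has the same kernel as `M`, and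
then the same range. The choice of `z` is free up to `ker M`, so `w` is unique and the local smooth
solutions glue. -/
lemma exists_contDiffOn_solution_of_symmetric [FiniteDimensional ℝ E]
    {U : Set X} (hU : IsOpen U) {M : X → E →L[ℝ] E →L[ℝ] ℝ} {c : X → E →L[ℝ] ℝ} {N : ℕ}
    (hM : ContDiffOn ℝ ∞ M U) (hc : ContDiffOn ℝ ∞ c U)
    (hsymm : ∀ x ∈ U, ∀ a b, M x a b = M x b a)
    (hrank : ∀ x ∈ U, Module.finrank ℝ (LinearMap.ker (M x : E →ₗ[ℝ] E →L[ℝ] ℝ)) = N)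
    (hr : ∀ x ∈ U, c x ∈ range (M x)) :
    ∃ w : X → E, ContDiffOn ℝ ∞ w U ∧ ∀ x ∈ U, M x (w x) = c x := by
  obtain ⟨J, hJ⟩ := exists_symmetric_pos_dual (E := E)
  set A : X → E →L[ℝ] E →L[ℝ] ℝ := fun x => (M x).comp (J.comp (M x)) with hA
  have hz : ∀ x ∈ U, ∀ z, A x z = 0 → M x z = 0 := by
    intro x hx z h
    apply hJ
    have h1 : M x (J (M x z)) z = 0 := by
      have : M x (J (M x z)) = 0 := h
      rw [this]; rfl
    rw [hsymm x hx] at h1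
    exact h1
  have hker : ∀ x ∈ U, LinearMap.ker (A x : E →ₗ[ℝ] E →L[ℝ] ℝ) =
      LinearMap.ker (M x : E →ₗ[ℝ] E →L[ℝ] ℝ) := by
    intro x hx
    ext z
    refine ⟨fun h => hz x hx z h, fun h => ?_⟩
    have h' : M x z = 0 := h
    change M x (J (M x z)) = 0
    rw [h', map_zero, map_zero]
  have hrange : ∀ x ∈ U, c x ∈ range (A x) := by
    intro x hx
    have h1 : LinearMap.range (A x : E →ₗ[ℝ] E →L[ℝ] ℝ) =
        LinearMap.range (M x : E →ₗ[ℝ] E →L[ℝ] ℝ) := by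
      apply Submodule.eq_of_le_of_finrank_eq
      · rintro _ ⟨z, rfl⟩
        exact ⟨J (M x z), rfl⟩
      · have h4 := LinearMap.finrank_range_add_finrank_ker (A x : E →ₗ[ℝ] E →L[ℝ] ℝ)
        have h5 := LinearMap.finrank_range_add_finrank_ker (M x : E →ₗ[ℝ] E →L[ℝ] ℝ)
        rw [hker x hx] at h4
        omega
    have h2 : c x ∈ LinearMap.range (M x : E →ₗ[ℝ] E →L[ℝ] ℝ) := hr x hx
    rw [← h1] at h2
    exact h2
  -- This choice of `z` has no regularity; only `M x (z x)`, which the equation determines, is used.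
  choose! z hzc using hrange
  refine ⟨fun x => J (M x (z x)), fun x₀ hx₀ => ?_, fun x hx => hzc x hx⟩
  have hUx := hU.mem_nhds hx₀
  have hMd := hM.contDiffAt hUx
  have hAd : ContDiffAt ℝ ∞ A x₀ := hMd.clm_comp (contDiffAt_const.clm_comp hMd)
  obtain ⟨w, hw, hwc⟩ := exists_contDiffAt_solution hAd (hc.contDiffAt hUx)
    (by filter_upwards [hUx] with x hx; rw [hker x hx, hker x₀ hx₀, hrank x hx, hrank x₀ hx₀])
    (by filter_upwards [hUx] with x hx; exact ⟨z x, hzc x hx⟩)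
  have hd : ContDiffAt ℝ ∞ (fun x => J (M x (w x))) x₀ :=
    contDiffAt_const.clm_apply (hMd.clm_apply hw)
  refine (hd.congr_of_eventuallyEq ?_).contDiffWithinAt
  filter_upwards [hUx, hwc] with x hx hx'
  have h1 : A x (z x - w x) = 0 := by rw [map_sub, hzc x hx, hx', sub_self]
  have h2 := hz x hx _ h1
  rw [map_sub, sub_eq_zero] at h2
  rw [h2]

lemma exists_inverse_of_nondegenerate {V : Type*} [NormedAddCommGroup V] [NormedSpace ℝ V]
    [FiniteDimensional ℝ V] (B : V →ₗ[ℝ] Module.Dual ℝ V)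
    (hB : ∀ ξ, (∀ η, B ξ η = 0) → ξ = 0) :
    ∃ J : (V →L[ℝ] ℝ) →L[ℝ] V, ∀ σ η, B (J σ) η = σ η := by
  have hinj : Function.Injective B := by
    rw [← LinearMap.ker_eq_bot, LinearMap.ker_eq_bot']
    exact fun ξ h => hB ξ fun η => by rw [h]; rfl
  let e := LinearEquiv.ofInjectiveOfFinrankEq B hinj (Subspace.dual_finrank_eq (K := ℝ)).symm
  let r : (V →L[ℝ] ℝ) →ₗ[ℝ] Module.Dual ℝ V :=
    (LinearMap.toContinuousLinearMap (𝕜 := ℝ) (E := V) (F' := ℝ)).symm.toLinearMap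
  refine ⟨LinearMap.toContinuousLinearMap (e.symm.toLinearMap ∘ₗ r), fun σ η => ?_⟩
  have : B (e.symm (r σ)) = r σ := e.apply_symm_apply (r σ)
  exact congrArg (fun f => f η) this

lemma eq_zero_of_canonical_pairing {ξ : E × (E →L[ℝ] ℝ)}
    (h : ∀ η : E × (E →L[ℝ] ℝ), η.2 ξ.1 - ξ.2 η.1 = 0) : ξ = 0 := by
  have h2 : ξ.2 = 0 := by
    ext b
    simpa using h (b, 0)
  have h1 : ξ.1 = 0 := by
    by_contra hne
    obtain ⟨f, -, hf⟩ := exists_dual_vector ℝ ξ.1 (norm_ne_zero_iff.2 hne)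
    have := h (0, f)
    simp only [map_zero, sub_zero] at this
    rw [this] at hf
    exact hne (norm_eq_zero.1 (by simpa using hf.symm))
  exact Prod.ext h1 h2

/-- Turns differentials into Hamiltonian vectors in canonical coordinates. `J` is linear and
independent of the base point, so smoothness of the resulting fields is automatic. -/
lemma exists_inverse_of_canonical_pairing [FiniteDimensional ℝ E] :
    ∃ J : ((E × (E →L[ℝ] ℝ)) →L[ℝ] ℝ) →L[ℝ] E × (E →L[ℝ] ℝ),
      ∀ σ η, η.2 (J σ).1 - (J σ).2 η.1 = σ η :=
  exists_inverse_of_nondegenerate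
    (LinearMap.mk₂ ℝ (fun ξ η : E × (E →L[ℝ] ℝ) => η.2 ξ.1 - ξ.2 η.1)
      (fun a b c => by simp; ring) (fun r a b => by simp; ring)
      (fun a b c => by simp; ring) (fun r a b => by simp; ring))
    fun _ h => eq_zero_of_canonical_pairing h

end LinearAlgebra

/-! ### Pullback of exterior derivatives and Lie brackets on vector spaces. -/

section Calculus

variable {F F' : Type*} [NormedAddCommGroup F] [NormedSpace ℝ F]
  [NormedAddCommGroup F'] [NormedSpace ℝ F']

lemma hasFDerivAt_comp_const {G : Type*} [NormedAddCommGroup G] [NormedSpace ℝ G]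
    {p : F → G →L[ℝ] ℝ} {p' : F →L[ℝ] G →L[ℝ] ℝ} {y : F} (hp : HasFDerivAt p p' y)
    (l : F →L[ℝ] G) :
    HasFDerivAt (fun z => (p z).comp l)
      (((ContinuousLinearMap.compL ℝ F G ℝ).flip l).comp p') y :=
  ((ContinuousLinearMap.compL ℝ F G ℝ).flip l).hasFDerivAt.comp y hp

/-- The exterior derivative of a one-form on a vector space commutes with pullback. -/
lemma fderiv_pullback_sub {Θ : F' → F' →L[ℝ] ℝ} {ψ : F → F'} {y : F}
    (hΘ : DifferentiableAt ℝ Θ (ψ y)) (hψ : ContDiffAt ℝ 2 ψ y) (ξ η : F) :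
    fderiv ℝ (fun z => (Θ (ψ z)).comp (fderiv ℝ ψ z)) y ξ η -
      fderiv ℝ (fun z => (Θ (ψ z)).comp (fderiv ℝ ψ z)) y η ξ =
    fderiv ℝ Θ (ψ y) (fderiv ℝ ψ y ξ) (fderiv ℝ ψ y η) -
      fderiv ℝ Θ (ψ y) (fderiv ℝ ψ y η) (fderiv ℝ ψ y ξ) := by
  have h1 : HasFDerivAt (fun z => Θ (ψ z)) ((fderiv ℝ Θ (ψ y)).comp (fderiv ℝ ψ y)) y :=
    hΘ.hasFDerivAt.comp y (hψ.differentiableAt (by simp)).hasFDerivAt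
  have h2 : DifferentiableAt ℝ (fderiv ℝ ψ) y :=
    (hψ.fderiv_right (m := 1) (by norm_num)).differentiableAt (by simp)
  have h3 := (h1.clm_comp h2.hasFDerivAt).fderiv
  have hs : fderiv ℝ (fderiv ℝ ψ) y ξ η = fderiv ℝ (fderiv ℝ ψ) y η ξ :=
    (hψ.isSymmSndFDerivAt (by simp)) ξ η
  rw [h3]
  simp [hs]

/-- A Lie bracket acts on functions as the commutator of the derivations. -/
lemma fderiv_lieBracket_apply {f : F → F'} {V W : F → F} {y : F} (hf : ContDiffAt ℝ 2 f y)
    (hV : DifferentiableAt ℝ V y) (hW : DifferentiableAt ℝ W y) :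
    fderiv ℝ f y (VectorField.lieBracket ℝ V W y) =
      fderiv ℝ (fun z => fderiv ℝ f z (W z)) y (V y) -
        fderiv ℝ (fun z => fderiv ℝ f z (V z)) y (W y) := by
  have h2 : DifferentiableAt ℝ (fderiv ℝ f) y :=
    (hf.fderiv_right (m := 1) (by norm_num)).differentiableAt (by simp)
  have hs : fderiv ℝ (fderiv ℝ f) y (V y) (W y) = fderiv ℝ (fderiv ℝ f) y (W y) (V y) :=
    (hf.isSymmSndFDerivAt (by simp)) _ _
  rw [(h2.hasFDerivAt.clm_apply hW.hasFDerivAt).fderiv,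
    (h2.hasFDerivAt.clm_apply hV.hasFDerivAt).fderiv]
  simp [VectorField.lieBracket, hs]

end Calculus

end SingularLagrangian

/-! ### Hausdorff total spaces; exterior derivatives and Lie brackets in charts of a manifold. -/

namespace SingularLagrangian

/-- Points over different base points are separated by the projection, points of one fibre inside a
trivialization. Applied to `T^*Q`, where bump functions are needed. -/
lemma t2Space_totalSpace {B F : Type*} [TopologicalSpace B] [TopologicalSpace F] [T2Space B]
    [T2Space F] (E : B → Type*) [TopologicalSpace (Bundle.TotalSpace F E)]
    [∀ b, TopologicalSpace (E b)] [FiberBundle F E] : T2Space (Bundle.TotalSpace F E) := by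
  refine ⟨fun x y hxy => ?_⟩
  by_cases h : x.proj = y.proj
  · let e := trivializationAt F E x.proj
    have hx : x ∈ e.source := e.mem_source.2 (FiberBundle.mem_baseSet_trivializationAt' _)
    have hy : y ∈ e.source := e.mem_source.2 (h ▸ FiberBundle.mem_baseSet_trivializationAt' _)
    have hne : e x ≠ e y := fun h' => hxy (e.injOn hx hy h')
    obtain ⟨U, V, hU, hV, hxU, hyV, hUV⟩ := t2_separation hne
    refine ⟨e.source ∩ e ⁻¹' U, e.source ∩ e ⁻¹' V,
      e.toOpenPartialHomeomorph.isOpen_inter_preimage hU,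
      e.toOpenPartialHomeomorph.isOpen_inter_preimage hV, ⟨hx, hxU⟩, ⟨hy, hyV⟩, ?_⟩
    exact (hUV.preimage e).mono inter_subset_right inter_subset_right
  · exact separated_by_continuous (FiberBundle.continuous_proj F E) h

section Manifold

variable {F : Type*} [NormedAddCommGroup F] [NormedSpace ℝ F]
  {H : Type*} [TopologicalSpace H] {I : ModelWithCorners ℝ F H} [I.Boundaryless]
  {M : Type*} [TopologicalSpace M] [ChartedSpace H M] [IsManifold I ∞ M]
  {F' : Type*} [NormedAddCommGroup F'] [NormedSpace ℝ F']
  {H' : Type*} [TopologicalSpace H'] {I' : ModelWithCorners ℝ F' H'} [I'.Boundaryless]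
  {M' : Type*} [TopologicalSpace M'] [ChartedSpace H' M'] [IsManifold I' ∞ M']

lemma contMDiffAt_extChartAt_symm {x₀ : M} {y : F} (hy : y ∈ (extChartAt I x₀).target) :
    ContMDiffAt 𝓘(ℝ, F) I ∞ (extChartAt I x₀).symm y :=
  (contMDiffOn_extChartAt_symm x₀).contMDiffAt ((isOpen_extChartAt_target x₀).mem_nhds hy)

lemma mdifferentiableAt_extChartAt_symm {x₀ : M} {y : F} (hy : y ∈ (extChartAt I x₀).target) :
    MDifferentiableAt 𝓘(ℝ, F) I (extChartAt I x₀).symm y :=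
  (contMDiffAt_extChartAt_symm hy).mdifferentiableAt (by simp)

lemma mdifferentiableAt_extChartAt_of_mem {x₀ x : M} (hx : x ∈ (extChartAt I x₀).source) :
    MDifferentiableAt I 𝓘(ℝ, F) (extChartAt I x₀) x :=
  (contMDiffAt_extChartAt' (n := ∞) (by simpa using hx)).mdifferentiableAt (by simp)

/-- The pullback of a one-form along a map from a vector space. -/
def pullbackOneForm (I : ModelWithCorners ℝ F H) (θ : M → F →L[ℝ] ℝ) (g : F → M) (y : F) :
    F →L[ℝ] ℝ :=
  (θ (g y)).comp (show F →L[ℝ] F from mfderiv 𝓘(ℝ, F) I g y)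

lemma pullbackOneForm_congr {θ : M → F →L[ℝ] ℝ} {g g' : F → M} {y : F} (h : g =ᶠ[𝓝 y] g') :
    pullbackOneForm I θ g y = pullbackOneForm I θ g' y := by
  have h1 : (show F →L[ℝ] F from mfderiv 𝓘(ℝ, F) I g y) = mfderiv 𝓘(ℝ, F) I g' y :=
    h.mfderiv_eq
  unfold pullbackOneForm
  rw [h1, h.eq_of_nhds]

lemma pullbackOneForm_comp {θ : M → F →L[ℝ] ℝ} {g : F → M} {ψ : F → F} {y : F}
    (hg : MDifferentiableAt 𝓘(ℝ, F) I g (ψ y)) (hψ : DifferentiableAt ℝ ψ y) :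
    pullbackOneForm I θ (g ∘ ψ) y = (pullbackOneForm I θ g (ψ y)).comp (fderiv ℝ ψ y) := by
  unfold pullbackOneForm
  have h := mfderiv_comp y hg hψ.mdifferentiableAt
  rw [mfderiv_eq_fderiv] at h
  ext v
  exact congrArg (θ (g (ψ y))) (congrArg (fun f => f v) h)

/-- The exterior derivative may be computed in any chart of the atlas. -/
lemma extD_eq_of_mem_source {θ : ∀ x : M, TangentSpace I x →L[ℝ] ℝ} {x₀ x : M}
    (hx : x ∈ (extChartAt I x₀).source)
    (hθ : DifferentiableAt ℝ (oneFormInChart I θ x₀) (extChartAt I x₀ x))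
    (ξ η : TangentSpace I x) :
    extD I θ x ξ η =
      fderiv ℝ (oneFormInChart I θ x₀) (extChartAt I x₀ x)
          (mfderiv I 𝓘(ℝ, F) (extChartAt I x₀) x ξ) (mfderiv I 𝓘(ℝ, F) (extChartAt I x₀) x η) -
        fderiv ℝ (oneFormInChart I θ x₀) (extChartAt I x₀ x)
          (mfderiv I 𝓘(ℝ, F) (extChartAt I x₀) x η)
          (mfderiv I 𝓘(ℝ, F) (extChartAt I x₀) x ξ) := by
  set φ := extChartAt I x with hφ
  set φ₀ := extChartAt I x₀ with hφ₀
  set ψ : F → F := φ₀ ∘ φ.symm with hψ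
  have hxx : x ∈ φ.source := mem_extChartAt_source x
  have hinv : φ.symm (φ x) = x := φ.left_inv hxx
  have hψx : ψ (φ x) = φ₀ x := congrArg φ₀ hinv
  have hψd : ContDiffAt ℝ ∞ ψ (φ x) := by
    rw [← contMDiffAt_iff_contDiffAt]
    refine ContMDiffAt.comp (φ x) (I' := I) ?_
      (contMDiffAt_extChartAt_symm (mem_extChartAt_target x))
    rw [hinv]
    exact contMDiffAt_extChartAt' (by rwa [hφ₀, extChartAt_source] at hx)
  have hev : ∀ᶠ y in 𝓝 (φ x), φ.symm =ᶠ[𝓝 y] φ₀.symm ∘ ψ ∧ ψ y ∈ φ₀.target ∧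
      DifferentiableAt ℝ ψ y := by
    have h1 : ∀ᶠ y in 𝓝 (φ x), φ.symm y ∈ φ₀.source := by
      apply (continuousAt_extChartAt_symm x).eventually_mem
      rw [← hφ, hinv]
      exact (isOpen_extChartAt_source x₀).mem_nhds hx
    have h2 : ∀ᶠ y in 𝓝 (φ x), DifferentiableAt ℝ ψ y := by
      filter_upwards [(hψd.of_le (m := 1) (by simp)).eventually (by simp)] with y hy
      exact hy.differentiableAt (by simp)
    filter_upwards [h1.eventually_nhds, h2] with y hy hy2
    refine ⟨?_, φ₀.map_source hy.self_of_nhds, hy2⟩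
    filter_upwards [hy] with z hz
    exact (φ₀.left_inv hz).symm
  -- The coordinate form is by definition the pullback along the inverse chart. The two inverse
  -- charts differ by the transition map `ψ`, so invariance reduces to `fderiv_pullback_sub`.
  have hform : oneFormInChart I θ x =ᶠ[𝓝 (φ x)]
      fun y => (oneFormInChart I θ x₀ (ψ y)).comp (fderiv ℝ ψ y) := by
    filter_upwards [hev] with y ⟨h1, h2, h3⟩
    exact (pullbackOneForm_congr (θ := θ) h1).trans
      (pullbackOneForm_comp (mdifferentiableAt_extChartAt_symm h2) h3)
  have hD : ∀ ζ : TangentSpace I x, mfderiv I 𝓘(ℝ, F) φ₀ x ζ = fderiv ℝ ψ (φ x) (dChart I x ζ) := by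
    intro ζ
    have h1 : φ₀ =ᶠ[𝓝 x] ψ ∘ φ := by
      filter_upwards [extChartAt_source_mem_nhds (I := I) x] with z hz
      exact congrArg φ₀ (φ.left_inv hz).symm
    have h2 : MDifferentiableAt 𝓘(ℝ, F) 𝓘(ℝ, F) ψ (φ x) :=
      (hψd.differentiableAt (by simp)).mdifferentiableAt
    have h3 := mfderiv_comp x h2 (mdifferentiableAt_extChartAt_of_mem hxx)
    rw [mfderiv_eq_fderiv] at h3
    have h4 : mfderiv I 𝓘(ℝ, F) φ₀ x = mfderiv I 𝓘(ℝ, F) (ψ ∘ φ) x := h1.mfderiv_eq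
    exact congrArg (fun f => f ζ) (h4.trans h3)
  rw [hD, hD, ← hψx]
  unfold extD
  rw [← hφ, hform.fderiv_eq]
  exact fderiv_pullback_sub (by rw [hψx]; exact hθ) (hψd.of_le ENat.LEInfty.out) _ _

/-- The derivative of a vector-valued function along a vector field. -/
def dAlong (I : ModelWithCorners ℝ F H) (f : M → F') (V : ∀ x : M, TangentSpace I x) (y : M) : F' :=
  mfderiv I 𝓘(ℝ, F') f y (V y)

/-- The manifold bracket is the vector-space bracket of the fields pulled back to the preferred
chart, where `fderiv_lieBracket_apply` applies. It will be used with `f` the fibre derivative read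
in a chart, so that the left side determines the pushforward of the bracket. -/
lemma dAlong_mlieBracket [CompleteSpace F] {f : M → F'} {V W : ∀ x : M, TangentSpace I x}
    {x : M}
    (hf : ContMDiffAt I 𝓘(ℝ, F') 2 f x)
    (hV : MDifferentiableAt I I.tangent (fun y => (⟨y, V y⟩ : TangentBundle I M)) x)
    (hW : MDifferentiableAt I I.tangent (fun y => (⟨y, W y⟩ : TangentBundle I M)) x) :
    dAlong I f (VectorField.mlieBracket I V W) x =
      dAlong I (dAlong I f W) V x - dAlong I (dAlong I f V) W x := by
  have : IsManifold I 2 M := IsManifold.of_le (n := ∞) ENat.LEInfty.out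
  set φ := extChartAt I x with hφ
  set fc : F → F' := f ∘ φ.symm with hfc
  have hxx : x ∈ φ.source := mem_extChartAt_source x
  have hxt : φ x ∈ φ.target := mem_extChartAt_target x
  have hinv : φ.symm (φ x) = x := φ.left_inv hxx
  have hfcd : ContDiffAt ℝ 2 fc (φ x) := by
    rw [← contMDiffAt_iff_contDiffAt]
    refine ContMDiffAt.comp (φ x) (I' := I) ?_
      ((contMDiffAt_extChartAt_symm hxt).of_le ENat.LEInfty.out)
    rw [hinv]; exact hf
  have hloc : ∀ᶠ y in 𝓝 x, y ∈ φ.source ∧ DifferentiableAt ℝ fc (φ y) := by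
    have h1 : ∀ᶠ z in 𝓝 (φ x), DifferentiableAt ℝ fc z := by
      filter_upwards [hfcd.eventually (by simp)] with z hz
      exact hz.differentiableAt (by simp)
    exact (Filter.eventually_mem_set.2 (extChartAt_source_mem_nhds (I := I) x)).and
      ((continuousAt_extChartAt (I := I) x).eventually h1)
  have hfφ : ∀ y ∈ φ.source, f =ᶠ[𝓝 y] fc ∘ φ := by
    intro y hy
    filter_upwards [(isOpen_extChartAt_source (I := I) x).mem_nhds hy] with z hz
    exact congrArg f (φ.left_inv hz).symm
  have hcomp : ∀ {g : M → F'} {k : F → F'} {y : M}, y ∈ φ.source → DifferentiableAt ℝ k (φ y) →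
      g =ᶠ[𝓝 y] k ∘ φ → ∀ v : TangentSpace I y, (mfderiv I 𝓘(ℝ, F') g y v : F') =
        fderiv ℝ k (φ y) (mfderiv I 𝓘(ℝ, F) φ y v) := by
    intro g k y hy hk hg v
    have h3 := mfderiv_comp y hk.mdifferentiableAt (mdifferentiableAt_extChartAt_of_mem hy)
    rw [mfderiv_eq_fderiv] at h3
    have h4 : mfderiv I 𝓘(ℝ, F') g y = mfderiv I 𝓘(ℝ, F') (k ∘ φ) y := hg.mfderiv_eq
    exact congrArg (fun f => f v) (h4.trans h3)
  let pull : (∀ x : M, TangentSpace I x) → F → F := fun V =>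
    VectorField.mpullbackWithin 𝓘(ℝ, F) I φ.symm V (range I)
  have hpull : ∀ (V : ∀ x : M, TangentSpace I x), ∀ y ∈ φ.source,
      pull V (φ y) = dAlong I φ V y := by
    intro V y hy
    have h1 := mfderivWithin_extChartAt_symm_comp_mfderiv_extChartAt (I := I) (φ.map_source hy)
    have h2 := mfderiv_extChartAt_comp_mfderivWithin_extChartAt_symm (I := I) (φ.map_source hy)
    have h3 := ContinuousLinearMap.inverse_eq h1 h2
    have h4 : pull V (φ y) = dAlong I φ V (φ.symm (φ y)) :=
      congrArg (fun f => f (V (φ.symm (φ y)))) h3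
    rw [h4, φ.left_inv hy]
  have hpulld : ∀ {V : ∀ x : M, TangentSpace I x},
      MDifferentiableAt I I.tangent (fun y => (⟨y, V y⟩ : TangentBundle I M)) x →
      DifferentiableAt ℝ (pull V) (φ x) := by
    intro V hV
    have h : DifferentiableWithinAt ℝ (pull V) (φ.symm ⁻¹' univ ∩ range I) (φ x) :=
      MDifferentiableWithinAt.differentiableWithinAt_mpullbackWithin_vectorField
        (hV.mdifferentiableWithinAt (s := univ))
    rw [preimage_univ, univ_inter] at h
    exact DifferentiableWithinAt.differentiableAt (E := F) (F := F) h (by rw [I.range_eq_univ]; exact univ_mem)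
  have hsecond : ∀ {V : ∀ x : M, TangentSpace I x},
      MDifferentiableAt I I.tangent (fun y => (⟨y, V y⟩ : TangentBundle I M)) x →
      ∀ W : ∀ x : M, TangentSpace I x, dAlong I (dAlong I f V) W x =
        fderiv ℝ (fun z => fderiv ℝ fc z (pull V z)) (φ x) (pull W (φ x)) := by
    intro V hV W
    have h2 : DifferentiableAt ℝ (fderiv ℝ fc) (φ x) :=
      (hfcd.fderiv_right (m := 1) (by norm_num)).differentiableAt (by simp)
    rw [hpull W x hxx]
    refine hcomp hxx (h2.clm_apply (hpulld hV)) ?_ (W x)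
    filter_upwards [hloc] with y ⟨hy1, hy2⟩
    simp only [Function.comp_apply, hpull V y hy1]
    exact hcomp hy1 hy2 (hfφ y hy1) (V y)
  have hbr : dAlong I φ (VectorField.mlieBracket I V W) x =
      VectorField.lieBracket ℝ (pull V) (pull W) (φ x) := by
    have h1 := (isInvertible_mfderiv_extChartAt (I := I) hxx).self_comp_inverse
    have h2 : VectorField.lieBracket ℝ (pull V) (pull W) (φ x) =
        VectorField.lieBracketWithin ℝ (pull V) (pull W) (φ.symm ⁻¹' univ ∩ range I) (φ x) := by
      rw [I.range_eq_univ, preimage_univ, univ_inter, VectorField.lieBracketWithin_univ]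
    let b : F := VectorField.lieBracketWithin ℝ (pull V) (pull W)
      (φ.symm ⁻¹' univ ∩ range I) (φ x)
    exact (congrArg (fun f => f b) h1).trans h2.symm
  rw [hsecond hV, hsecond hW]
  refine (hcomp hxx (hfcd.differentiableAt (by simp)) (hfφ x hxx) _).trans ?_
  exact (congrArg (fderiv ℝ fc (φ x)) hbr).trans
    (fderiv_lieBracket_apply hfcd (hpulld hV) (hpulld hW))

end Manifold

end SingularLagrangian

/-! ### Explicit charts of `TQ` and `T^*Q` induced by a chart of `Q`. -/

namespace SingularLagrangian
variable {E : Type*} [NormedAddCommGroup E] [NormedSpace ℝ E]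
  {Q : Type*} [TopologicalSpace Q] [ChartedSpace E Q] [IsManifold 𝓘(ℝ, E) ∞ Q]

lemma mem_extChartAt_PL_source {u₀ u : PL E Q} :
    u ∈ (extChartAt (IL E) u₀).source ↔ u.proj ∈ (chartAt E u₀.proj).source := by
  rw [extChartAt_source, TangentBundle.mem_chart_source_iff]

lemma mem_extChartAt_PC_source {s₀ s : PC E Q} :
    s ∈ (extChartAt (IC E) s₀).source ↔ s.proj ∈ (chartAt E s₀.proj).source := by
  rw [extChartAt_source, FiberBundle.chartedSpace_chartAt]
  simp only [mfld_simps]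
  constructor
  · exact fun h => h.1.1
  · intro h
    have h1 : s ∈ (trivializationAt (E →L[ℝ] ℝ)
        (fun x => TangentSpace 𝓘(ℝ, E) x →L[ℝ] Bundle.Trivial Q ℝ x) s₀.proj).source :=
      (Bundle.Trivialization.mem_source _).2 ⟨h, mem_univ _⟩
    refine ⟨⟨h, mem_univ _⟩, ?_⟩
    rw [Bundle.Trivialization.coe_fst _ h1]
    exact h

lemma mem_extChartAt_PL_target {u₀ : PL E Q} {y : E × E} :
    y ∈ (extChartAt (IL E) u₀).target ↔ y.1 ∈ (chartAt E u₀.proj).target := by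
  rw [extChartAt_target, ModelWithCorners.range_eq_univ, inter_univ]
  exact TangentBundle.mem_chart_target_iff (I := 𝓘(ℝ, E)) y u₀

/-- The isomorphism from the model space to the tangent space at `q` given by the chart at `q₀`. -/
def frame (q₀ q : Q) : E →L[ℝ] E :=
  (trivializationAt E (TangentSpace 𝓘(ℝ, E)) q₀).symmL ℝ q

/-- The inverse of `frame`. -/
def coframe (q₀ q : Q) : E →L[ℝ] E :=
  (trivializationAt E (TangentSpace 𝓘(ℝ, E)) q₀).continuousLinearMapAt ℝ q

lemma coframe_frame {q₀ q : Q} (h : q ∈ (chartAt E q₀).source) (v : E) :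
    coframe q₀ q (frame q₀ q v) = v :=
  (trivializationAt E (TangentSpace 𝓘(ℝ, E)) q₀).continuousLinearMapAt_symmL (R := ℝ)
    (by simpa using h) v

lemma frame_coframe {q₀ q : Q} (h : q ∈ (chartAt E q₀).source) (v : E) :
    frame q₀ q (coframe q₀ q v) = v :=
  (trivializationAt E (TangentSpace 𝓘(ℝ, E)) q₀).symmL_continuousLinearMapAt (R := ℝ)
    (by simpa using h) v

lemma extChartAt_PL_apply {u₀ u : PL E Q} (h : u.proj ∈ (chartAt E u₀.proj).source) :
    extChartAt (IL E) u₀ u = (chartAt E u₀.proj u.proj, coframe u₀.proj u.proj (show E from u.snd)) := by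
  have h1 : coframe u₀.proj u.proj (show E from u.snd) =
      (trivializationAt E (TangentSpace 𝓘(ℝ, E)) u₀.proj u).2 := by
    change (trivializationAt E (TangentSpace 𝓘(ℝ, E)) u₀.proj).continuousLinearMapAt ℝ u.proj
      u.snd = _
    rw [Bundle.Trivialization.continuousLinearMapAt_apply,
      Bundle.Trivialization.coe_linearMapAt_of_mem _ (by simpa using h)]
  rw [h1]
  simp [extChartAt, FiberBundle.chartedSpace_chartAt]

lemma extChartAt_PL_symm_apply {u₀ : PL E Q} {y : E × E} (h : y.1 ∈ (chartAt E u₀.proj).target) :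
    (extChartAt (IL E) u₀).symm y = ⟨(chartAt E u₀.proj).symm y.1,
      frame (E := E) u₀.proj ((chartAt E u₀.proj).symm y.1) y.2⟩ := by
  have hs : (chartAt E u₀.proj).symm y.1 ∈ (chartAt E u₀.proj).source :=
    (chartAt E u₀.proj).map_target h
  refine (extChartAt (IL E) u₀).injOn
    ((extChartAt (IL E) u₀).map_target (mem_extChartAt_PL_target.2 h))
    (mem_extChartAt_PL_source.2 hs) ?_
  rw [(extChartAt (IL E) u₀).right_inv (mem_extChartAt_PL_target.2 h), extChartAt_PL_apply hs]
  exact Prod.ext ((chartAt E u₀.proj).right_inv h).symm (coframe_frame hs _).symm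

lemma extChartAt_PC_apply {s₀ s : PC E Q} :
    extChartAt (IC E) s₀ s = (chartAt E s₀.proj s.proj,
      (show E →L[ℝ] ℝ from s.snd).comp (frame s₀.proj s.proj)) := by
  simp only [extChartAt, OpenPartialHomeomorph.extend_coe, Function.comp_apply, hom_chart]
  refine Prod.ext rfl ?_
  ext v
  exact congrArg (fun f => f ((show E →L[ℝ] ℝ from s.snd) (frame s₀.proj s.proj v)))
    (Bundle.Trivial.continuousLinearMapAt_trivialization ℝ Q ℝ s.proj)

lemma frame_self (q : Q) (v : E) : frame q q v = v := by
  have h := TangentBundle.symmL_trivializationAt (I := 𝓘(ℝ, E)) (mem_chart_source E q)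
  have h2 := mfderivWithin_range_extChartAt_symm (I := 𝓘(ℝ, E)) (x := q)
  exact congrArg (fun f => f v) (h.trans h2)

/-- The differential at `u` of the chart of `TQ` at `u₀`. -/
def dChL (u₀ u : PL E Q) : TangentSpace (IL E) u →L[ℝ] E × E :=
  mfderiv (IL E) 𝓘(ℝ, E × E) (extChartAt (IL E) u₀) u

/-- The differential at `s` of the chart of `T^*Q` at `s₀`. -/
def dChC (s₀ s : PC E Q) : TangentSpace (IC E) s →L[ℝ] E × (E →L[ℝ] ℝ) :=
  mfderiv (IC E) 𝓘(ℝ, E × (E →L[ℝ] ℝ)) (extChartAt (IC E) s₀) s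

lemma isInvertible_dChL {u₀ u : PL E Q} (h : u.proj ∈ (chartAt E u₀.proj).source) :
    (dChL u₀ u).IsInvertible :=
  isInvertible_mfderiv_extChartAt (I := IL E) (mem_extChartAt_PL_source.2 h)

lemma isInvertible_dChC {s₀ s : PC E Q} (h : s.proj ∈ (chartAt E s₀.proj).source) :
    (dChC s₀ s).IsInvertible :=
  isInvertible_mfderiv_extChartAt (I := IC E) (mem_extChartAt_PC_source.2 h)

/-- Differentiates the identity "first chart component equals base chart after projection". The same
argument serves `TQ` and `T^*Q`. -/
lemma mfderiv_proj_aux {F : Type*} [NormedAddCommGroup F] [NormedSpace ℝ F]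
    {H : Type*} [TopologicalSpace H] {I : ModelWithCorners ℝ F H}
    {M : Type*} [TopologicalSpace M] [ChartedSpace H M] {pr : M → Q} {q₀ : Q}
    {x : M} {F' : Type*} [NormedAddCommGroup F'] [NormedSpace ℝ F'] {φ : M → E × F'}
    (hpr : MDifferentiableAt I 𝓘(ℝ, E) pr x) (hφ : MDifferentiableAt I 𝓘(ℝ, E × F') φ x)
    (hx : pr x ∈ (chartAt E q₀).source) (h : ∀ᶠ y in 𝓝 x, (φ y).1 = chartAt E q₀ (pr y))
    (ξ : TangentSpace I x) :
    (show E from mfderiv I 𝓘(ℝ, E) pr x ξ) =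
      frame q₀ (pr x) (show E × F' from mfderiv I 𝓘(ℝ, E × F') φ x ξ).1 := by
  have h1 : MDifferentiableAt 𝓘(ℝ, E) 𝓘(ℝ, E) (extChartAt 𝓘(ℝ, E) q₀) (pr x) :=
    mdifferentiableAt_extChartAt hx
  have h2 : (extChartAt 𝓘(ℝ, E) q₀) ∘ pr =ᶠ[𝓝 x] Prod.fst ∘ φ := by
    filter_upwards [h] with y hy
    simp [hy]
  have h3 : mfderiv I 𝓘(ℝ, E) ((extChartAt 𝓘(ℝ, E) q₀) ∘ pr) x =
      mfderiv I 𝓘(ℝ, E) (Prod.fst ∘ φ) x := h2.mfderiv_eq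
  have h4 := mfderiv_comp x h1 hpr
  have h5 : MDifferentiableAt 𝓘(ℝ, E × F') 𝓘(ℝ, E) (Prod.fst : E × F' → E) (φ x) :=
    differentiableAt_fst.mdifferentiableAt
  have h6 := mfderiv_comp x h5 hφ
  rw [mfderiv_eq_fderiv, fderiv_fst] at h6
  have h7 : coframe q₀ (pr x) (show E from mfderiv I 𝓘(ℝ, E) pr x ξ) =
      (show E × F' from mfderiv I 𝓘(ℝ, E × F') φ x ξ).1 := by
    have h8 := TangentBundle.continuousLinearMapAt_trivializationAt (I := 𝓘(ℝ, E)) hx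
    have h9 := congrArg (fun f => f ξ) (h4.symm.trans (h3.trans h6))
    have h10 := congrArg (fun f => f (mfderiv I 𝓘(ℝ, E) pr x ξ)) h8
    exact h10.trans h9
  rw [← h7, frame_coframe hx]

lemma dTau_eq {u₀ u : PL E Q} (h : u.proj ∈ (chartAt E u₀.proj).source)
    (ξ : TangentSpace (IL E) u) :
    (show E from dTau u ξ) = frame u₀.proj u.proj (dChL u₀ u ξ).1 := by
  have hopen : ∀ᶠ w : PL E Q in 𝓝 u, w.proj ∈ (chartAt E u₀.proj).source :=
    (FiberBundle.continuous_proj E (TangentSpace 𝓘(ℝ, E))).continuousAt.eventually_mem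
      ((chartAt E u₀.proj).open_source.mem_nhds h)
  refine mfderiv_proj_aux (I := IL E) (pr := fun w : PL E Q => w.proj)
    (φ := extChartAt (IL E) u₀)
    ((Bundle.contMDiff_proj (n := ∞) (TangentSpace 𝓘(ℝ, E))).mdifferentiableAt (by simp))
    (mdifferentiableAt_extChartAt_of_mem (mem_extChartAt_PL_source.2 h)) h ?_ ξ
  filter_upwards [hopen] with w hw
  rw [extChartAt_PL_apply hw]

lemma mfderiv_proj_PC_eq {s₀ s : PC E Q} (h : s.proj ∈ (chartAt E s₀.proj).source)
    (ξ : TangentSpace (IC E) s) :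
    (show E from mfderiv (IC E) 𝓘(ℝ, E) (fun r : PC E Q => r.proj) s ξ) =
      frame s₀.proj s.proj (dChC s₀ s ξ).1 := by
  refine mfderiv_proj_aux (I := IC E) (pr := fun w : PC E Q => w.proj)
    (φ := extChartAt (IC E) s₀)
    ((Bundle.contMDiff_proj (n := ∞)
      (fun x : Q => TangentSpace 𝓘(ℝ, E) x →L[ℝ] Bundle.Trivial Q ℝ x)).mdifferentiableAt (by simp))
    (mdifferentiableAt_extChartAt_of_mem (mem_extChartAt_PC_source.2 h)) h ?_ ξ
  exact Filter.Eventually.of_forall fun w => by rw [extChartAt_PC_apply]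

end SingularLagrangian

/-! ### The fibre derivative, its differential and the Hessian in coordinates. -/

namespace SingularLagrangian
variable {E : Type*} [NormedAddCommGroup E] [NormedSpace ℝ E]
  {Q : Type*} [TopologicalSpace Q] [ChartedSpace E Q] [IsManifold 𝓘(ℝ, E) ∞ Q]

/-- The Lagrangian in the chart of `TQ` at `u₀`. -/
def lagCoord (L : PL E Q → ℝ) (u₀ : PL E Q) (y : E × E) : ℝ := L ((extChartAt (IL E) u₀).symm y)

/-- The momenta `∂L/∂v` in the chart of `TQ` at `u₀`. -/
def momCoord (L : PL E Q → ℝ) (u₀ : PL E Q) (y : E × E) : E →L[ℝ] ℝ :=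
  (fderiv ℝ (lagCoord L u₀) y).comp (ContinuousLinearMap.inr ℝ E E)

/-- The fibre derivative in the charts of `TQ` and `T^*Q` at `u₀`. -/
def legCoord (L : PL E Q → ℝ) (u₀ : PL E Q) (y : E × E) : E × (E →L[ℝ] ℝ) :=
  (y.1, momCoord L u₀ y)

/-- The Hessian in the chart of `TQ` at `u₀`. -/
def hessCoord (L : PL E Q → ℝ) (u₀ : PL E Q) (y : E × E) : E →L[ℝ] E →L[ℝ] ℝ :=
  (fderiv ℝ (momCoord L u₀) y).comp (ContinuousLinearMap.inr ℝ E E)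

variable {L : PL E Q → ℝ}

lemma contDiffOn_lagCoord (hL : ContMDiff (IL E) 𝓘(ℝ, ℝ) ∞ L) (u₀ : PL E Q) :
    ContDiffOn ℝ ∞ (lagCoord L u₀) (extChartAt (IL E) u₀).target := by
  rw [← contMDiffOn_iff_contDiffOn]
  exact hL.comp_contMDiffOn (contMDiffOn_extChartAt_symm u₀)

lemma contDiffOn_momCoord (hL : ContMDiff (IL E) 𝓘(ℝ, ℝ) ∞ L) (u₀ : PL E Q) :
    ContDiffOn ℝ ∞ (momCoord L u₀) (extChartAt (IL E) u₀).target :=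
  ((contDiffOn_lagCoord hL u₀).fderiv_of_isOpen (isOpen_extChartAt_target u₀)
    (by simp)).clm_comp contDiffOn_const

lemma contDiffOn_legCoord (hL : ContMDiff (IL E) 𝓘(ℝ, ℝ) ∞ L) (u₀ : PL E Q) :
    ContDiffOn ℝ ∞ (legCoord L u₀) (extChartAt (IL E) u₀).target :=
  contDiffOn_fst.prodMk (contDiffOn_momCoord hL u₀)

lemma contDiffOn_fderiv_momCoord (hL : ContMDiff (IL E) 𝓘(ℝ, ℝ) ∞ L) (u₀ : PL E Q) :
    ContDiffOn ℝ ∞ (fderiv ℝ (momCoord L u₀)) (extChartAt (IL E) u₀).target :=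
  (contDiffOn_momCoord hL u₀).fderiv_of_isOpen (isOpen_extChartAt_target u₀) (by simp)

lemma contDiffOn_hessCoord (hL : ContMDiff (IL E) 𝓘(ℝ, ℝ) ∞ L) (u₀ : PL E Q) :
    ContDiffOn ℝ ∞ (hessCoord L u₀) (extChartAt (IL E) u₀).target :=
  (contDiffOn_fderiv_momCoord hL u₀).clm_comp contDiffOn_const

lemma differentiableAt_momCoord (hL : ContMDiff (IL E) 𝓘(ℝ, ℝ) ∞ L) {u₀ : PL E Q} {y : E × E}
    (hy : y ∈ (extChartAt (IL E) u₀).target) : DifferentiableAt ℝ (momCoord L u₀) y :=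
  ((contDiffOn_momCoord hL u₀).contDiffAt ((isOpen_extChartAt_target u₀).mem_nhds hy)
    ).differentiableAt (by simp)

lemma differentiableAt_lagCoord (hL : ContMDiff (IL E) 𝓘(ℝ, ℝ) ∞ L) {u₀ : PL E Q} {y : E × E}
    (hy : y ∈ (extChartAt (IL E) u₀).target) : DifferentiableAt ℝ (lagCoord L u₀) y :=
  ((contDiffOn_lagCoord hL u₀).contDiffAt ((isOpen_extChartAt_target u₀).mem_nhds hy)
    ).differentiableAt (by simp)

lemma hessCoord_symm (hL : ContMDiff (IL E) 𝓘(ℝ, ℝ) ∞ L) {u₀ : PL E Q} {y : E × E}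
    (hy : y ∈ (extChartAt (IL E) u₀).target) (a b : E) :
    hessCoord L u₀ y a b = hessCoord L u₀ y b a := by
  have hd : ContDiffAt ℝ ∞ (lagCoord L u₀) y :=
    (contDiffOn_lagCoord hL u₀).contDiffAt ((isOpen_extChartAt_target u₀).mem_nhds hy)
  have h2 : DifferentiableAt ℝ (fderiv ℝ (lagCoord L u₀)) y :=
    ((hd.of_le (m := 2) ENat.LEInfty.out).fderiv_right (m := 1) (by norm_num)).differentiableAt (by simp)
  have hs : ∀ a b, fderiv ℝ (fderiv ℝ (lagCoord L u₀)) y a b =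
      fderiv ℝ (fderiv ℝ (lagCoord L u₀)) y b a :=
    (hd.of_le (m := 2) ENat.LEInfty.out).isSymmSndFDerivAt (by simp)
  have h3 : ∀ a b, hessCoord L u₀ y a b =
      fderiv ℝ (fderiv ℝ (lagCoord L u₀)) y (0, a) (0, b) := by
    intro a b
    have h4 := (h2.hasFDerivAt.clm_comp
      (hasFDerivAt_const (ContinuousLinearMap.inr ℝ E E) y)).fderiv
    unfold hessCoord momCoord
    rw [h4]
    simp
  rw [h3, h3, hs]

/-- The fibre coordinate of the chart at `u₀` is linear on the fibres. -/
lemma lagCoord_apply {u₀ : PL E Q} {q : Q} (hq : q ∈ (chartAt E u₀.proj).source) (v : E) :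
    lagCoord L u₀ (chartAt E u₀.proj q, v) = L ⟨q, frame (E := E) u₀.proj q v⟩ := by
  unfold lagCoord
  rw [extChartAt_PL_symm_apply ((chartAt E u₀.proj).map_source hq)]
  exact congrArg (fun q' : Q => L ⟨q', frame (E := E) u₀.proj q' v⟩)
    ((chartAt E u₀.proj).left_inv hq)

lemma chart_mem_target {u₀ : PL E Q} {q : Q} (hq : q ∈ (chartAt E u₀.proj).source) (v : E) :
    (chartAt E u₀.proj q, v) ∈ (extChartAt (IL E) u₀).target :=
  mem_extChartAt_PL_target.2 ((chartAt E u₀.proj).map_source hq)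

lemma lagrangian_fibre_eq {u₀ : PL E Q} {q : Q} (hq : q ∈ (chartAt E u₀.proj).source) :
    (fun w : E => L ⟨q, w⟩) =
      fun w => lagCoord L u₀ (chartAt E u₀.proj q, coframe u₀.proj q w) := by
  funext w
  rw [lagCoord_apply hq, frame_coframe hq]

lemma fibreDeriv_eq (hL : ContMDiff (IL E) 𝓘(ℝ, ℝ) ∞ L) {u₀ : PL E Q} {q : Q}
    (hq : q ∈ (chartAt E u₀.proj).source) (w : E) :
    fibreDeriv L q w =
      (momCoord L u₀ (chartAt E u₀.proj q, coframe u₀.proj q w)).comp (coframe u₀.proj q) := by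
  unfold fibreDeriv momCoord
  rw [lagrangian_fibre_eq hq]
  have h1 := (differentiableAt_lagCoord hL (chart_mem_target hq (coframe u₀.proj q w))).hasFDerivAt
  have h2 : HasFDerivAt (fun w => (chartAt E u₀.proj q, coframe u₀.proj q w))
      ((ContinuousLinearMap.inr ℝ E E).comp (coframe u₀.proj q)) w :=
    (hasFDerivAt_prodMk_right _ _).comp w (coframe u₀.proj q).hasFDerivAt
  exact (h1.comp w h2).fderiv

lemma momCoord_eq (hL : ContMDiff (IL E) 𝓘(ℝ, ℝ) ∞ L) {u₀ : PL E Q} {q : Q}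
    (hq : q ∈ (chartAt E u₀.proj).source) (w : E) :
    momCoord L u₀ (chartAt E u₀.proj q, coframe u₀.proj q w) =
      (fibreDeriv L q w).comp (frame u₀.proj q) := by
  rw [fibreDeriv_eq hL hq]
  ext v
  simp [coframe_frame hq]

lemma hessian_eq (hL : ContMDiff (IL E) 𝓘(ℝ, ℝ) ∞ L) {u₀ u : PL E Q}
    (hu : u.proj ∈ (chartAt E u₀.proj).source) (a b : E) :
    hessian L u a b = hessCoord L u₀ (extChartAt (IL E) u₀ u)
      (coframe u₀.proj u.proj a) (coframe u₀.proj u.proj b) := by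
  rw [extChartAt_PL_apply hu]
  unfold hessian hessCoord
  rw [funext (fibreDeriv_eq hL hu)]
  set w : E := u.snd
  have h1 := (differentiableAt_momCoord hL
    (chart_mem_target hu (coframe u₀.proj u.proj w))).hasFDerivAt
  have h2 : HasFDerivAt (fun w => (chartAt E u₀.proj u.proj, coframe u₀.proj u.proj w))
      ((ContinuousLinearMap.inr ℝ E E).comp (coframe u₀.proj u.proj)) w :=
    (hasFDerivAt_prodMk_right _ _).comp w (coframe u₀.proj u.proj).hasFDerivAt
  have h3 := ((h1.comp w h2).clm_comp (hasFDerivAt_const (coframe u₀.proj u.proj) w)).fderiv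
  refine (congrArg (fun f => f a b) h3).trans ?_
  simp

lemma finrank_ker_hessCoord (hL : ContMDiff (IL E) 𝓘(ℝ, ℝ) ∞ L) {u₀ u : PL E Q}
    (hu : u.proj ∈ (chartAt E u₀.proj).source) :
    Module.finrank ℝ (LinearMap.ker
      (hessCoord L u₀ (extChartAt (IL E) u₀ u) : E →ₗ[ℝ] E →L[ℝ] ℝ)) =
    Module.finrank ℝ (LinearMap.ker (hessian L u : E →ₗ[ℝ] E →L[ℝ] ℝ)) := by
  let e : E ≃ₗ[ℝ] E :=
    { (frame (E := E) u₀.proj u.proj).toLinearMap with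
      invFun := coframe u₀.proj u.proj
      left_inv := coframe_frame hu
      right_inv := frame_coframe hu }
  have h : LinearMap.ker (hessian L u : E →ₗ[ℝ] E →L[ℝ] ℝ) = (LinearMap.ker
      (hessCoord L u₀ (extChartAt (IL E) u₀ u) : E →ₗ[ℝ] E →L[ℝ] ℝ)).map e.toLinearMap := by
    ext v
    rw [Submodule.mem_map_equiv]
    change hessian L u v = 0 ↔
      hessCoord L u₀ (extChartAt (IL E) u₀ u) (coframe u₀.proj u.proj v) = 0
    constructor
    · intro h
      ext b
      rw [← coframe_frame hu b, ← hessian_eq hL hu, h]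
      rfl
    · intro h
      ext b
      rw [hessian_eq hL hu, h]
      rfl
  rw [h]
  exact (LinearEquiv.finrank_map_eq e _).symm

lemma extChartAt_legendre (hL : ContMDiff (IL E) 𝓘(ℝ, ℝ) ∞ L) {u₀ u : PL E Q}
    (hu : u.proj ∈ (chartAt E u₀.proj).source) :
    extChartAt (IC E) (legendre L u₀) (legendre L u) = legCoord L u₀ (extChartAt (IL E) u₀ u) := by
  rw [extChartAt_PC_apply, extChartAt_PL_apply hu]
  exact Prod.ext rfl (momCoord_eq hL hu u.snd).symm

lemma legendre_mem_source {u₀ u : PL E Q} (hu : u.proj ∈ (chartAt E u₀.proj).source) :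
    legendre L u ∈ (extChartAt (IC E) (legendre L u₀)).source :=
  (mem_extChartAt_PC_source (s₀ := legendre L u₀) (s := legendre L u)).2 hu

lemma contMDiff_legendre (hL : ContMDiff (IL E) 𝓘(ℝ, ℝ) ∞ L) :
    ContMDiff (IL E) (IC E) ∞ (legendre L) := by
  intro u₀
  have hmem : ∀ᶠ u in 𝓝 u₀, u ∈ (extChartAt (IL E) u₀).source :=
    extChartAt_source_mem_nhds u₀
  have heq : legendre L =ᶠ[𝓝 u₀] (extChartAt (IC E) (legendre L u₀)).symm ∘ legCoord L u₀ ∘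
      extChartAt (IL E) u₀ := by
    filter_upwards [hmem] with u hu
    rw [mem_extChartAt_PL_source] at hu
    simp only [Function.comp_apply]
    rw [← extChartAt_legendre hL hu]
    exact ((extChartAt (IC E) (legendre L u₀)).left_inv (legendre_mem_source hu)).symm
  refine ContMDiffAt.congr_of_eventuallyEq ?_ heq
  have h0 := extChartAt_legendre hL (mem_chart_source E u₀.proj)
  refine ContMDiffAt.comp u₀ (I' := 𝓘(ℝ, E × (E →L[ℝ] ℝ))) ?_
    (ContMDiffAt.comp u₀ (I' := 𝓘(ℝ, E × E)) ?_ contMDiffAt_extChartAt)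
  · apply contMDiffAt_extChartAt_symm
    simp only [Function.comp_apply]
    rw [← h0]
    exact mem_extChartAt_target _
  · exact ((contDiffOn_legCoord hL u₀).contDiffAt
      (extChartAt_target_mem_nhds u₀)).contMDiffAt

/-- The charts stay those at `u₀` and `ℒ(u₀)` while `u` varies over the chart domain, so that a
lifting problem for fields becomes a linear system with smooth coefficients. -/
lemma dChC_dLegendre (hL : ContMDiff (IL E) 𝓘(ℝ, ℝ) ∞ L) {u₀ u : PL E Q}
    (hu : u.proj ∈ (chartAt E u₀.proj).source) (ξ : TangentSpace (IL E) u) :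
    dChC (legendre L u₀) (legendre L u) (dLegendre L u ξ) =
      ((dChL u₀ u ξ).1,
        fderiv ℝ (momCoord L u₀) (extChartAt (IL E) u₀ u) (dChL u₀ u ξ)) := by
  have hus := mem_extChartAt_PL_source.2 hu
  have hut := (extChartAt (IL E) u₀).map_source hus
  have heq : extChartAt (IC E) (legendre L u₀) ∘ legendre L =ᶠ[𝓝 u]
      legCoord L u₀ ∘ extChartAt (IL E) u₀ := by
    filter_upwards [(isOpen_extChartAt_source u₀).mem_nhds hus] with w hw
    exact extChartAt_legendre hL (mem_extChartAt_PL_source.1 hw)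
  have h1 := mfderiv_comp u (I' := IC E) (g := extChartAt (IC E) (legendre L u₀))
    (f := legendre L) (mdifferentiableAt_extChartAt_of_mem (legendre_mem_source hu))
    ((contMDiff_legendre hL).mdifferentiable (by simp) u)
  have hmom := differentiableAt_momCoord hL hut
  have hleg : HasFDerivAt (legCoord L u₀) ((ContinuousLinearMap.fst ℝ E E).prod
      (fderiv ℝ (momCoord L u₀) (extChartAt (IL E) u₀ u))) (extChartAt (IL E) u₀ u) :=
    hasFDerivAt_fst.prodMk hmom.hasFDerivAt
  have h2 := mfderiv_comp u (I' := 𝓘(ℝ, E × E)) (g := legCoord L u₀)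
    (f := extChartAt (IL E) u₀) hleg.differentiableAt.mdifferentiableAt
    (mdifferentiableAt_extChartAt_of_mem hus)
  rw [mfderiv_eq_fderiv, hleg.fderiv] at h2
  have h3 : mfderiv (IL E) 𝓘(ℝ, E × (E →L[ℝ] ℝ))
      (extChartAt (IC E) (legendre L u₀) ∘ legendre L) u =
      mfderiv (IL E) 𝓘(ℝ, E × (E →L[ℝ] ℝ)) (legCoord L u₀ ∘ extChartAt (IL E) u₀) u :=
    heq.mfderiv_eq
  exact congrArg (fun f => f ξ) (h1.symm.trans (h3.trans h2))

end SingularLagrangian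

/-! ### The two-forms in coordinates and the kernel of the pushforward. -/

namespace SingularLagrangian
variable {E : Type*} [NormedAddCommGroup E] [NormedSpace ℝ E]
  {Q : Type*} [TopologicalSpace Q] [ChartedSpace E Q] [IsManifold 𝓘(ℝ, E) ∞ Q]
  {L : PL E Q → ℝ}

lemma mfderiv_extChartAt_symm_apply {F : Type*} [NormedAddCommGroup F] [NormedSpace ℝ F]
    {H : Type*} [TopologicalSpace H] {I : ModelWithCorners ℝ F H} [I.Boundaryless]
    {M : Type*} [TopologicalSpace M] [ChartedSpace H M] [IsManifold I ∞ M] {x₀ : M} {y : F}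
    (hy : y ∈ (extChartAt I x₀).target) (η : F) :
    (mfderiv I 𝓘(ℝ, F) (extChartAt I x₀) ((extChartAt I x₀).symm y)
      (mfderiv 𝓘(ℝ, F) I (extChartAt I x₀).symm y η) : F) = η := by
  have : IsManifold I 1 M := IsManifold.of_le (n := ∞) (by simp)
  have h := mfderiv_extChartAt_comp_mfderivWithin_extChartAt_symm (I := I) hy
  rw [I.range_eq_univ, mfderivWithin_univ] at h
  exact congrArg (fun f => f η) h

lemma oneFormInChart_thetaL (hL : ContMDiff (IL E) 𝓘(ℝ, ℝ) ∞ L) {u₀ : PL E Q} {y : E × E}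
    (hy : y ∈ (extChartAt (IL E) u₀).target) :
    oneFormInChart (IL E) (thetaL L) u₀ y = (momCoord L u₀ y).comp (ContinuousLinearMap.fst ℝ E E) := by
  have hu : ((extChartAt (IL E) u₀).symm y).proj ∈ (chartAt E u₀.proj).source :=
    mem_extChartAt_PL_source.1 ((extChartAt (IL E) u₀).map_target hy)
  have hchart := (extChartAt (IL E) u₀).right_inv hy
  refine ContinuousLinearMap.ext fun η => ?_
  have h1 : dChL u₀ ((extChartAt (IL E) u₀).symm y)
      (mfderiv 𝓘(ℝ, E × E) (IL E) (extChartAt (IL E) u₀).symm y η) = η :=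
    mfderiv_extChartAt_symm_apply hy η
  set u := (extChartAt (IL E) u₀).symm y
  have h2 := dTau_eq hu (mfderiv 𝓘(ℝ, E × E) (IL E) (extChartAt (IL E) u₀).symm y η)
  rw [h1] at h2
  rw [extChartAt_PL_apply hu] at hchart
  have h3 := momCoord_eq hL hu (show E from u.snd)
  rw [hchart] at h3
  rw [h3]
  exact congrArg (fibreDeriv L u.proj u.snd) h2

lemma oneFormInChart_canonicalOneForm {s₀ : PC E Q} {y : E × (E →L[ℝ] ℝ)}
    (hy : y ∈ (extChartAt (IC E) s₀).target) :
    oneFormInChart (IC E) canonicalOneForm s₀ y = y.2.comp (ContinuousLinearMap.fst ℝ E _) := by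
  have hu : ((extChartAt (IC E) s₀).symm y).proj ∈ (chartAt E s₀.proj).source :=
    mem_extChartAt_PC_source.1 ((extChartAt (IC E) s₀).map_target hy)
  have hchart := (extChartAt (IC E) s₀).right_inv hy
  refine ContinuousLinearMap.ext fun η => ?_
  have h1 : dChC s₀ ((extChartAt (IC E) s₀).symm y)
      (mfderiv 𝓘(ℝ, E × (E →L[ℝ] ℝ)) (IC E) (extChartAt (IC E) s₀).symm y η) = η :=
    mfderiv_extChartAt_symm_apply hy η
  set s := (extChartAt (IC E) s₀).symm y
  have h2 := mfderiv_proj_PC_eq hu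
    (mfderiv 𝓘(ℝ, E × (E →L[ℝ] ℝ)) (IC E) (extChartAt (IC E) s₀).symm y η)
  rw [h1] at h2
  rw [extChartAt_PC_apply] at hchart
  have h3 : (show E →L[ℝ] ℝ from s.snd).comp (frame s₀.proj s.proj) = y.2 := congrArg Prod.snd hchart
  rw [← h3]
  exact congrArg (show E →L[ℝ] ℝ from s.snd) h2

/-- Induced charts of `T^*Q` are Darboux charts: the canonical one-form reads `p dq` in each of
them, so its exterior derivative has constant coefficients. -/
lemma canonicalForm_eq {s₀ s : PC E Q} (hs : s.proj ∈ (chartAt E s₀.proj).source)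
    (ξ η : TangentSpace (IC E) s) :
    canonicalForm s ξ η =
      (dChC s₀ s η).2 (dChC s₀ s ξ).1 - (dChC s₀ s ξ).2 (dChC s₀ s η).1 := by
  have hss := mem_extChartAt_PC_source.2 hs
  have hst := (extChartAt (IC E) s₀).map_source hss
  have h1 : oneFormInChart (IC E) canonicalOneForm s₀ =ᶠ[𝓝 (extChartAt (IC E) s₀ s)]
      fun y => y.2.comp (ContinuousLinearMap.fst ℝ E (E →L[ℝ] ℝ)) := by
    filter_upwards [(isOpen_extChartAt_target s₀).mem_nhds hst] with y hy
    exact oneFormInChart_canonicalOneForm hy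
  have h3 := (hasFDerivAt_comp_const (hasFDerivAt_snd (𝕜 := ℝ) (p := extChartAt (IC E) s₀ s))
    (ContinuousLinearMap.fst ℝ E (E →L[ℝ] ℝ))).congr_of_eventuallyEq h1
  unfold canonicalForm
  rw [extD_eq_of_mem_source hss h3.differentiableAt, h3.fderiv]
  change -((dChC s₀ s ξ).2 (dChC s₀ s η).1 - (dChC s₀ s η).2 (dChC s₀ s ξ).1) = _
  ring

/-- In coordinates `θ_L` is `p dq` with `p` the momentum function, so both sides are the same
antisymmetrization of the derivative of `p`. -/
lemma omegaL_eq (hL : ContMDiff (IL E) 𝓘(ℝ, ℝ) ∞ L) (u : PL E Q)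
    (ξ η : TangentSpace (IL E) u) :
    omegaL L u ξ η = canonicalForm (legendre L u) (dLegendre L u ξ) (dLegendre L u η) := by
  have hu := mem_chart_source E u.proj
  have h1 : oneFormInChart (IL E) (thetaL L) u =ᶠ[𝓝 (extChartAt (IL E) u u)]
      fun y => (momCoord L u y).comp (ContinuousLinearMap.fst ℝ E E) := by
    filter_upwards [extChartAt_target_mem_nhds (I := IL E) u] with y hy
    exact oneFormInChart_thetaL hL hy
  have h2 := (hasFDerivAt_comp_const
    (differentiableAt_momCoord hL (mem_extChartAt_target u)).hasFDerivAt
    (ContinuousLinearMap.fst ℝ E E)).congr_of_eventuallyEq h1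
  rw [canonicalForm_eq (s₀ := legendre L u) (s := legendre L u) hu, dChC_dLegendre hL hu, dChC_dLegendre hL hu]
  unfold omegaL
  rw [extD_eq_of_mem_source (mem_extChartAt_source u) h2.differentiableAt, h2.fderiv]
  change -(fderiv ℝ (momCoord L u) (extChartAt (IL E) u u) (dChL u u ξ) (dChL u u η).1 -
    fderiv ℝ (momCoord L u) (extChartAt (IL E) u u) (dChL u u η) (dChL u u ξ).1) = _
  ring

lemma canonicalForm_add_left (s : PC E Q) (ξ ξ' η : TangentSpace (IC E) s) :
    canonicalForm s (ξ + ξ') η = canonicalForm s ξ η + canonicalForm s ξ' η := by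
  unfold canonicalForm
  rw [extD_add_left]
  ring

lemma canonicalForm_smul_left (s : PC E Q) (c : ℝ) (ξ η : TangentSpace (IC E) s) :
    canonicalForm s (c • ξ) η = c * canonicalForm s ξ η := by
  unfold canonicalForm
  rw [extD_smul_left]
  ring

/-- The canonical form is nondegenerate. -/
lemma eq_zero_of_canonicalForm {s : PC E Q} {ξ : TangentSpace (IC E) s}
    (h : ∀ η, canonicalForm s ξ η = 0) : ξ = 0 := by
  have hs := mem_chart_source E s.proj
  have hinv := isInvertible_dChC hs
  have h0 : ∀ ζ : E × (E →L[ℝ] ℝ), ζ.2 (dChC s s ξ).1 - (dChC s s ξ).2 ζ.1 = 0 := by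
    intro ζ
    obtain ⟨η, rfl⟩ := hinv.surjective ζ
    rw [← canonicalForm_eq hs]
    exact h η
  apply hinv.injective
  rw [ContinuousLinearMap.map_zero]
  exact eq_zero_of_canonical_pairing h0

/-! ### Kernel and range of the pushforward -/

variable [FiniteDimensional ℝ E]

/-- The pushforward at `u` in the charts at `u`. -/
lemma dLegendre_eq_zero_iff (hL : ContMDiff (IL E) 𝓘(ℝ, ℝ) ∞ L) (u : PL E Q)
    (ξ : TangentSpace (IL E) u) :
    dLegendre L u ξ = 0 ↔ dTau u ξ = 0 ∧ ξ ∈ kerOmegaAt L u := by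
  have hu := mem_chart_source E u.proj
  have hT : dTau u ξ = 0 ↔ (dChL u u ξ).1 = 0 := by
    have h := dTau_eq hu ξ
    rw [frame_self] at h
    rw [← h]
    rfl
  have hinv := isInvertible_dChC (s₀ := legendre L u) (s := legendre L u) hu
  rw [hT]
  constructor
  · intro h
    have h1 := dChC_dLegendre hL hu ξ
    rw [h, ContinuousLinearMap.map_zero] at h1
    refine ⟨(congrArg Prod.fst h1).symm, fun η => ?_⟩
    rw [omegaL_eq hL, h]
    have h2 := canonicalForm_smul_left (legendre L u) 0 0 (dLegendre L u η)
    simpa using h2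
  · rintro ⟨h1, h2⟩
    apply hinv.injective
    rw [ContinuousLinearMap.map_zero, dChC_dLegendre hL hu]
    refine Prod.ext h1 ?_
    ext a
    -- The base component already vanishes, so pairing with a vector of base component `a` isolates
    -- the momentum component evaluated at `a`.
    obtain ⟨η, hη⟩ := (isInvertible_dChL (u₀ := u) hu).surjective (a, 0)
    have h3 := h2 η
    rw [omegaL_eq hL, canonicalForm_eq (s₀ := legendre L u) (s := legendre L u) hu, dChC_dLegendre hL hu,
      dChC_dLegendre hL hu, hη, h1] at h3
    simpa using h3

end SingularLagrangian

/-! ### Annihilators of independent forms; kernel and range dimensions of the pushforward. -/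

namespace SingularLagrangian

section DualFamilies

variable {V : Type*} [AddCommGroup V] [Module ℝ V] [TopologicalSpace V] [FiniteDimensional ℝ V]
  {N : ℕ} {f : Fin N → V →L[ℝ] ℝ} {R : Submodule ℝ V}

/-- The linear forms underlying a family of continuous linear forms. -/
def dualSpan (f : Fin N → V →L[ℝ] ℝ) : Submodule ℝ (Module.Dual ℝ V) :=
  Submodule.span ℝ (range fun n => (f n : V →ₗ[ℝ] ℝ))

lemma finrank_dualSpan (hf : LinearIndependent ℝ f) : Module.finrank ℝ (dualSpan f) = N := by
  have h : LinearIndependent ℝ (fun n => (f n : V →ₗ[ℝ] ℝ)) :=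
    hf.map' (ContinuousLinearMap.coeLM ℝ)
      (LinearMap.ker_eq_bot.2 ContinuousLinearMap.coe_injective)
  rw [dualSpan, finrank_span_eq_card h, Fintype.card_fin]

/-- `N` independent forms cut out a subspace of codimension `N`. It contains `R`, which has the same
codimension. -/
lemma eq_dualCoannihilator (hf : LinearIndependent ℝ f) (hR : ∀ ξ ∈ R, ∀ n, f n ξ = 0)
    (hdim : Module.finrank ℝ R + N = Module.finrank ℝ V) :
    R = (dualSpan f).dualCoannihilator := by
  apply Submodule.eq_of_le_of_finrank_eq
  · intro ξ hξ
    rw [Submodule.mem_dualCoannihilator]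
    intro φ hφ
    induction hφ using Submodule.span_induction with
    | mem x hx => obtain ⟨n, rfl⟩ := hx; exact hR ξ hξ n
    | zero => rfl
    | add x y _ _ hx hy => simp [hx, hy]
    | smul a x _ hx => simp [hx]
  · have h := Subspace.finrank_add_finrank_dualCoannihilator_eq (dualSpan f)
    rw [finrank_dualSpan hf] at h
    omega

lemma mem_of_forall_eq_zero (hf : LinearIndependent ℝ f) (hR : ∀ ξ ∈ R, ∀ n, f n ξ = 0)
    (hdim : Module.finrank ℝ R + N = Module.finrank ℝ V) {ξ : V} (hξ : ∀ n, f n ξ = 0) :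
    ξ ∈ R := by
  rw [eq_dualCoannihilator hf hR hdim, Submodule.mem_dualCoannihilator]
  intro φ hφ
  induction hφ using Submodule.span_induction with
  | mem x hx => obtain ⟨n, rfl⟩ := hx; exact hξ n
  | zero => rfl
  | add x y _ _ hx hy => simp [hx, hy]
  | smul a x _ hx => simp [hx]

lemma mem_dualSpan_of_forall_mem (hf : LinearIndependent ℝ f) (hR : ∀ ξ ∈ R, ∀ n, f n ξ = 0)
    (hdim : Module.finrank ℝ R + N = Module.finrank ℝ V) {σ : Module.Dual ℝ V}
    (hσ : ∀ ξ ∈ R, σ ξ = 0) : σ ∈ dualSpan f := by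
  rw [← Subspace.dualCoannihilator_dualAnnihilator_eq (W := dualSpan f),
    Submodule.mem_dualAnnihilator, ← eq_dualCoannihilator hf hR hdim]
  exact hσ

lemma mem_span_iff_mem_dualSpan {σ : V →L[ℝ] ℝ} :
    σ ∈ Submodule.span ℝ (range f) ↔ (σ : V →ₗ[ℝ] ℝ) ∈ dualSpan f := by
  have h : dualSpan f = (Submodule.span ℝ (range f)).map
      (ContinuousLinearMap.coeLM ℝ : (V →L[ℝ] ℝ) →ₗ[ℝ] V →ₗ[ℝ] ℝ) := by
    rw [Submodule.map_span, ← range_comp]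
    rfl
  rw [h]
  constructor
  · intro hσ
    exact ⟨σ, hσ, rfl⟩
  · rintro ⟨τ, hτ, h⟩
    rwa [← ContinuousLinearMap.coe_injective h]

lemma exists_mem_of_mem_dual {K : Submodule ℝ V} {S : Submodule ℝ (Module.Dual ℝ V)}
    {Φ : V →ₗ[ℝ] Module.Dual ℝ V} (hΦ : Function.Injective Φ) (hKS : ∀ ξ ∈ K, Φ ξ ∈ S)
    (hdim : Module.finrank ℝ K = Module.finrank ℝ S) {σ : Module.Dual ℝ V} (hσ : σ ∈ S) :
    ∃ ξ ∈ K, Φ ξ = σ := by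
  have h : K.map Φ = S := by
    apply Submodule.eq_of_le_of_finrank_eq
    · rintro _ ⟨ξ, hξ, rfl⟩
      exact hKS ξ hξ
    · rw [← (Submodule.equivMapOfInjective Φ hΦ K).finrank_eq, hdim]
  rw [← h] at hσ
  exact hσ

lemma finrank_map_add_finrank_ker {W : Type*} [AddCommGroup W] [Module ℝ W]
    {T : V →ₗ[ℝ] W} {K : Submodule ℝ V} (hK : LinearMap.ker T ≤ K) :
    Module.finrank ℝ (K.map T) + Module.finrank ℝ (LinearMap.ker T) = Module.finrank ℝ K := by
  have h := LinearMap.finrank_range_add_finrank_ker (T.domRestrict K)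
  rw [LinearMap.range_domRestrict, LinearMap.ker_domRestrict] at h
  rw [← h, ← Submodule.finrank_map_subtype_eq K, Submodule.map_comap_subtype,
    inf_eq_right.2 hK]

omit [FiniteDimensional ℝ V] in
lemma linearIndependent_of_surjective {W : Type*} [AddCommGroup W] [Module ℝ W]
    [TopologicalSpace W] {β : Fin N → W →L[ℝ] ℝ} (hβ : LinearIndependent ℝ β) {T : V → W}
    (hT : Function.Surjective T) (hf : ∀ n ξ, f n ξ = β n (T ξ)) : LinearIndependent ℝ f := by
  rw [Fintype.linearIndependent_iff] at hβ ⊢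
  intro c hc
  apply hβ c
  ext y
  obtain ⟨ξ, rfl⟩ := hT y
  have h := congrArg (fun g => g ξ) hc
  simpa [hf] using h

lemma exists_linearIndependent_mem {X : Type*} [AddCommGroup X] [Module ℝ X]
    [FiniteDimensional ℝ X] {P : Submodule ℝ X} (hdim : Module.finrank ℝ P = N) :
    ∃ β : Fin N → X, LinearIndependent ℝ β ∧ ∀ n, β n ∈ P := by
  let b := Module.finBasisOfFinrankEq ℝ P hdim
  exact ⟨fun n => b n, b.linearIndependent.map' P.subtype P.ker_subtype, fun n => (b n).2⟩

lemma exists_linearIndependent_annihilator [IsTopologicalAddGroup V] [ContinuousSMul ℝ V]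
    [T2Space V] (hdim : Module.finrank ℝ R + N = Module.finrank ℝ V) :
    ∃ β : Fin N → V →L[ℝ] ℝ, LinearIndependent ℝ β ∧ ∀ n, ∀ y ∈ R, β n y = 0 := by
  have hann : Module.finrank ℝ R.dualAnnihilator = N := by
    have := Subspace.finrank_add_finrank_dualAnnihilator_eq R
    omega
  obtain ⟨b, hb, hbR⟩ := exists_linearIndependent_mem (X := Module.Dual ℝ V) hann
  exact ⟨fun n => LinearMap.toContinuousLinearMap (b n),
    hb.map' (LinearMap.toContinuousLinearMap (𝕜 := ℝ) (E := V) (F' := ℝ)).toLinearMap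
      (LinearEquiv.ker _), fun n => (Submodule.mem_dualAnnihilator _).1 (hbR n)⟩

end DualFamilies

variable {E : Type*} [NormedAddCommGroup E] [NormedSpace ℝ E]
  {Q : Type*} [TopologicalSpace Q] [ChartedSpace E Q] [IsManifold 𝓘(ℝ, E) ∞ Q]
  {L : PL E Q → ℝ} [FiniteDimensional ℝ E]

instance (u : PL E Q) : FiniteDimensional ℝ (TangentSpace (IL E) u) :=
  inferInstanceAs (FiniteDimensional ℝ (E × E))

instance (s : PC E Q) : FiniteDimensional ℝ (TangentSpace (IC E) s) :=
  inferInstanceAs (FiniteDimensional ℝ (E × (E →L[ℝ] ℝ)))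

lemma finrank_tangent_PL (u : PL E Q) :
    Module.finrank ℝ (TangentSpace (IL E) u) = Module.finrank ℝ E + Module.finrank ℝ E :=
  (Module.finrank_prod (R := ℝ) (M := E) (M' := E) :)

lemma finrank_tangent_PC (s : PC E Q) :
    Module.finrank ℝ (TangentSpace (IC E) s) = Module.finrank ℝ E + Module.finrank ℝ E := by
  have h : Module.finrank ℝ (E × (E →L[ℝ] ℝ)) = Module.finrank ℝ E + Module.finrank ℝ E := by
    rw [Module.finrank_prod]
    congr 1
    rw [← (LinearMap.toContinuousLinearMap (𝕜 := ℝ) (E := E) (F' := ℝ)).finrank_eq]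
    exact Subspace.dual_finrank_eq
  exact h

/-- The pushforward as a linear map. -/
def pushL (L : PL E Q → ℝ) (u : PL E Q) :
    TangentSpace (IL E) u →ₗ[ℝ] TangentSpace (IC E) (legendre L u) :=
  (dLegendre L u).toLinearMap

/-- A vector in the kernel has zero base component, and what remains of the momentum equation is `M
w = 0`. The kernel is thus the vertical lift of `ker M`. -/
lemma finrank_ker_pushL (hL : ContMDiff (IL E) 𝓘(ℝ, ℝ) ∞ L) (u : PL E Q) :
    Module.finrank ℝ (LinearMap.ker (pushL L u)) =
      Module.finrank ℝ (LinearMap.ker (hessian L u : E →ₗ[ℝ] E →L[ℝ] ℝ)) := by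
  have hu := mem_chart_source E u.proj
  rw [← finrank_ker_hessCoord hL hu]
  obtain ⟨e, he⟩ := isInvertible_dChL (u₀ := u) hu
  have he' : ∀ ξ, dChL u u ξ = e ξ := fun ξ => congrArg (fun f => f ξ) he.symm
  let T : E →ₗ[ℝ] TangentSpace (IL E) u := e.symm.toLinearEquiv.toLinearMap ∘ₗ LinearMap.inr ℝ E E
  have hT : Function.Injective T :=
    e.symm.injective.comp LinearMap.inr_injective
  have h : LinearMap.ker (pushL L u) = (LinearMap.ker
      (hessCoord L u (extChartAt (IL E) u u) : E →ₗ[ℝ] E →L[ℝ] ℝ)).map T := by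
    ext ξ
    have h1 : pushL L u ξ = 0 ↔ (e ξ).1 = 0 ∧
        fderiv ℝ (momCoord L u) (extChartAt (IL E) u u) (e ξ) = 0 := by
      have h2 := dChC_dLegendre hL hu ξ
      rw [he'] at h2
      have h3 := (isInvertible_dChC (s₀ := legendre L u) (s := legendre L u) hu).injective
      constructor
      · intro h
        have h' : dLegendre L u ξ = 0 := h
        rw [h', ContinuousLinearMap.map_zero] at h2
        exact ⟨(congrArg Prod.fst h2).symm, (congrArg Prod.snd h2).symm⟩
      · rintro ⟨ha, hb⟩
        apply h3
        rw [ContinuousLinearMap.map_zero]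
        exact h2.trans (Prod.ext ha hb)
    rw [LinearMap.mem_ker, h1]
    constructor
    · rintro ⟨ha, hb⟩
      have hξ : e ξ = (0, (e ξ).2) := Prod.ext ha rfl
      refine ⟨(e ξ).2, ?_, ?_⟩
      · change fderiv ℝ (momCoord L u) (extChartAt (IL E) u u) (0, (e ξ).2) = 0
        rwa [← hξ]
      · change e.symm (0, (e ξ).2) = ξ
        rw [← hξ, e.symm_apply_apply]
    · rintro ⟨w, hw, rfl⟩
      have h4 : e (T w) = (0, w) := e.apply_symm_apply _
      rw [h4]
      exact ⟨rfl, hw⟩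
  rw [h]
  exact (Submodule.equivMapOfInjective T hT _).finrank_eq.symm

lemma finrank_range_pushL {N₀ : ℕ} (hL : IsAlmostRegular L N₀) (u : PL E Q) :
    Module.finrank ℝ (LinearMap.range (pushL L u)) + N₀ =
      Module.finrank ℝ (TangentSpace (IC E) (legendre L u)) := by
  have h := LinearMap.finrank_range_add_finrank_ker (pushL L u)
  rw [finrank_ker_pushL hL.smooth, hL.nullity] at h
  rw [h, finrank_tangent_PL, finrank_tangent_PC]

/-! ### Primary constraints and the range of the pushforward. -/

section Constraints

variable {N₀ : ℕ} {V : Set (PC E Q)} {γ : Fin N₀ → PC E Q → ℝ}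

lemma IsPrimaryConstraints.mdifferentiableAt (hγ : IsPrimaryConstraints L V γ) (n : Fin N₀)
    {s : PC E Q} (hs : s ∈ V) : MDifferentiableAt (IC E) 𝓘(ℝ, ℝ) (γ n) s :=
  ((hγ.smooth n).contMDiffAt (hγ.isOpen.mem_nhds hs)).mdifferentiableAt (by simp)

lemma dC_dLegendre_eq_zero (hL : ContMDiff (IL E) 𝓘(ℝ, ℝ) ∞ L)
    (hγ : IsPrimaryConstraints L V γ) {u : PL E Q} (hu : legendre L u ∈ V) (n : Fin N₀)
    (ξ : TangentSpace (IL E) u) : dC (γ n) (legendre L u) (dLegendre L u ξ) = 0 := by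
  have hl := contMDiff_legendre hL
  have h1 : γ n ∘ legendre L =ᶠ[𝓝 u] fun _ => (0 : ℝ) := by
    filter_upwards [hl.continuous.continuousAt.preimage_mem_nhds (hγ.isOpen.mem_nhds hu)] with w hw
    exact hγ.vanish n _ ⟨mem_range_self w, hw⟩
  have h2 := mfderiv_comp u (I' := IC E) (hγ.mdifferentiableAt n hu)
    (hl.mdifferentiable (by simp) u)
  have h3 : mfderiv (IL E) 𝓘(ℝ, ℝ) (γ n ∘ legendre L) u =
      mfderiv (IL E) 𝓘(ℝ, ℝ) (fun _ => (0 : ℝ)) u := h1.mfderiv_eq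
  rw [mfderiv_const] at h3
  exact congrArg (fun f => f ξ) (h2.symm.trans h3)

/-- Differentiating `γ_n ∘ ℒ = 0` gives one inclusion; equality holds because the range has
codimension `N₀` and the `N₀` differentials are independent. -/
lemma mem_range_dLegendre_iff (hL : IsAlmostRegular L N₀) (hγ : IsPrimaryConstraints L V γ)
    {u : PL E Q} (hu : legendre L u ∈ V) (ξ : TangentSpace (IC E) (legendre L u)) :
    ξ ∈ range (dLegendre L u) ↔ ξ ∈ primaryTangent γ (legendre L u) := by
  constructor
  · rintro ⟨η, rfl⟩ n
    exact dC_dLegendre_eq_zero hL.smooth hγ hu n η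
  · intro hξ
    refine mem_of_forall_eq_zero (R := LinearMap.range (pushL L u))
      (hγ.independent _ ⟨mem_range_self u, hu⟩) ?_ (finrank_range_pushL hL u) hξ
    rintro _ ⟨η, rfl⟩ n
    exact dC_dLegendre_eq_zero hL.smooth hγ hu n η

/-- The canonical form as a map from vectors to covectors. -/
def canonicalFlat (s : PC E Q) :
    TangentSpace (IC E) s →ₗ[ℝ] Module.Dual ℝ (TangentSpace (IC E) s) :=
  LinearMap.mk₂ ℝ (canonicalForm s) (canonicalForm_add_left s) (canonicalForm_smul_left s)
    (fun ξ η η' => by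
      have hs := mem_chart_source E s.proj
      rw [canonicalForm_eq hs, canonicalForm_eq hs, canonicalForm_eq hs,
        ContinuousLinearMap.map_add]
      simp only [Prod.fst_add, Prod.snd_add, ContinuousLinearMap.map_add,
        add_apply]
      ring)
    (fun c ξ η => by
      have hs := mem_chart_source E s.proj
      rw [canonicalForm_eq hs, canonicalForm_eq hs, ContinuousLinearMap.map_smul]
      simp only [Prod.smul_fst, Prod.smul_snd, ContinuousLinearMap.map_smul,
        smul_apply, smul_eq_mul]
      ring)

lemma canonicalFlat_apply (s : PC E Q) (ξ η : TangentSpace (IC E) s) :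
    canonicalFlat s ξ η = canonicalForm s ξ η := rfl

lemma canonicalFlat_injective (s : PC E Q) : Function.Injective (canonicalFlat s) := by
  rw [← LinearMap.ker_eq_bot, LinearMap.ker_eq_bot']
  intro ξ h
  refine eq_zero_of_canonicalForm fun η => ?_
  rw [← canonicalFlat_apply, h]
  rfl

/-- For `ξ` in `ker Ω_L` the pullback formula says that the covector kills the range of the
pushforward, and the annihilator of that range is spanned by the `dγ_n`. -/
lemma canonicalFlat_dLegendre_mem (hL : IsAlmostRegular L N₀) (hγ : IsPrimaryConstraints L V γ)
    {u : PL E Q} (hu : legendre L u ∈ V) {ξ : TangentSpace (IL E) u} (hξ : ξ ∈ kerOmegaAt L u) :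
    canonicalFlat (legendre L u) (dLegendre L u ξ) ∈
      dualSpan (fun n => dC (γ n) (legendre L u)) := by
  refine mem_dualSpan_of_forall_mem (R := LinearMap.range (pushL L u))
    (hγ.independent _ ⟨mem_range_self u, hu⟩) ?_ (finrank_range_pushL hL u) ?_
  · rintro _ ⟨η, rfl⟩ n
    exact dC_dLegendre_eq_zero hL.smooth hγ hu n η
  · rintro _ ⟨η, rfl⟩
    exact (omegaL_eq hL.smooth u ξ η).symm.trans (hξ η)

lemma ker_pushL_le_kerOmegaAt (hL : ContMDiff (IL E) 𝓘(ℝ, ℝ) ∞ L) (u : PL E Q) :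
    LinearMap.ker (pushL L u) ≤ kerOmegaAt L u := fun ξ hξ =>
  ((dLegendre_eq_zero_iff hL u ξ).1 hξ).2

/-- If `dim ker Ω_L = 2 N₀`, the image is coisotropic: the Hamiltonian vectors of the constraints
are pushforwards. -/
lemma exists_mem_kerOmegaAt (hL : IsAlmostRegular L N₀) (hγ : IsPrimaryConstraints L V γ)
    {u : PL E Q} (hdim : Module.finrank ℝ (kerOmegaAt L u) = 2 * N₀)
    (hu : legendre L u ∈ V) {ξ : TangentSpace (IC E) (legendre L u)}
    (hξ : canonicalFlat (legendre L u) ξ ∈ dualSpan (fun n => dC (γ n) (legendre L u))) :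
    ∃ η ∈ kerOmegaAt L u, dLegendre L u η = ξ := by
  -- The pushforward of `ker Ω_L` has dimension `2 N₀ - N₀ = N₀`, that of the span of the
  -- differentials; the injective map given by `ω` therefore identifies the two.
  have h1 := finrank_map_add_finrank_ker (ker_pushL_le_kerOmegaAt hL.smooth u)
  rw [finrank_ker_pushL hL.smooth, hL.nullity, hdim] at h1
  have h2 := finrank_dualSpan (hγ.independent _ ⟨mem_range_self u, hu⟩)
  obtain ⟨ξ', ⟨η, hη, rfl⟩, h⟩ := exists_mem_of_mem_dual (canonicalFlat_injective (legendre L u))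
    (K := (kerOmegaAt L u).map (pushL L u)) (by
      rintro _ ⟨η, hη, rfl⟩
      exact canonicalFlat_dLegendre_mem hL hγ hu hη) (by omega) hξ
  exact ⟨η, hη, canonicalFlat_injective _ h⟩

end Constraints

end SingularLagrangian

/-! ### Existence of primary constraints. -/

namespace SingularLagrangian
variable {E : Type*} [NormedAddCommGroup E] [NormedSpace ℝ E]
  {Q : Type*} [TopologicalSpace Q] [ChartedSpace E Q] [IsManifold 𝓘(ℝ, E) ∞ Q]
  {L : PL E Q → ℝ} {N₀ : ℕ}

lemma mfderiv_extend_bijective {F : Type*} [NormedAddCommGroup F] [NormedSpace ℝ F]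
    {H : Type*} [TopologicalSpace H] {I : ModelWithCorners ℝ F H} [I.Boundaryless]
    {M : Type*} [TopologicalSpace M] [ChartedSpace H M] [IsManifold I ∞ M]
    {φ : OpenPartialHomeomorph M H} (hφ : φ ∈ IsManifold.maximalAtlas I ∞ M) {x : M}
    (hx : x ∈ φ.source) :
    Function.Bijective (mfderiv I 𝓘(ℝ, F) (φ.extend I) x) := by
  have h1 := (φ.contMDiffAt_extend hφ hx).mdifferentiableAt (by simp)
  have hopen : IsOpen (I '' φ.target) := by
    have : I '' φ.target = I.toHomeomorph '' φ.target := rfl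
    rw [this]
    exact I.toHomeomorph.isOpenMap _ φ.open_target
  have hmem : φ.extend I x ∈ I '' φ.target := ⟨φ x, φ.map_source hx, rfl⟩
  have h2 : MDifferentiableAt 𝓘(ℝ, F) I (φ.extend I).symm (φ.extend I x) :=
    ((contMDiffOn_extend_symm hφ).contMDiffAt (hopen.mem_nhds hmem)).mdifferentiableAt (by simp)
  have hleft : (φ.extend I).symm (φ.extend I x) = x := φ.extend_left_inv hx
  constructor
  · have h3 := mfderiv_comp x h2 h1
    have h4 : (φ.extend I).symm ∘ φ.extend I =ᶠ[𝓝 x] id := by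
      filter_upwards [φ.open_source.mem_nhds hx] with z hz
      exact φ.extend_left_inv hz
    have h5 : mfderiv I I ((φ.extend I).symm ∘ φ.extend I) x = mfderiv I I id x := h4.mfderiv_eq
    rw [mfderiv_id] at h5
    exact Function.LeftInverse.injective (g := mfderiv 𝓘(ℝ, F) I (φ.extend I).symm (φ.extend I x))
      fun v => congrArg (fun f => f v) (h3.symm.trans h5)
  · have h1' : MDifferentiableAt I 𝓘(ℝ, F) (φ.extend I) ((φ.extend I).symm (φ.extend I x)) := by
      rw [hleft]; exact h1
    have h3 := mfderiv_comp (φ.extend I x) h1' h2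
    have h4 : φ.extend I ∘ (φ.extend I).symm =ᶠ[𝓝 (φ.extend I x)] id := by
      filter_upwards [hopen.mem_nhds hmem] with z hz
      obtain ⟨y, hy, rfl⟩ := hz
      simp [φ.right_inv hy]
    have h5 : mfderiv 𝓘(ℝ, F) 𝓘(ℝ, F) (φ.extend I ∘ (φ.extend I).symm) (φ.extend I x) =
        mfderiv 𝓘(ℝ, F) 𝓘(ℝ, F) id (φ.extend I x) := h4.mfderiv_eq
    rw [mfderiv_id] at h5
    have h6 : Function.Surjective (mfderiv I 𝓘(ℝ, F) (φ.extend I)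
        ((φ.extend I).symm (φ.extend I x))) :=
      Function.RightInverse.surjective
        (g := mfderiv 𝓘(ℝ, F) I (φ.extend I).symm (φ.extend I x))
        fun v => congrArg (fun f => f v) (h3.symm.trans h5)
    rwa [hleft] at h6

variable [FiniteDimensional ℝ E]

/-- A slice chart maps the image into a subspace `S`. Since the fibre derivative is a submersion
onto its image, `S` is the chart image of the range of the pushforward and has codimension `N₀`; the
constraints are `N₀` independent linear forms killing `S`, composed with the chart. -/
lemma exists_primaryConstraints (hL : IsAlmostRegular L N₀) (u : PL E Q) :
    ∃ (V : Set (PC E Q)) (γ : Fin N₀ → PC E Q → ℝ),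
      legendre L u ∈ V ∧ IsPrimaryConstraints L V γ := by
  obtain ⟨φ, hφ, hu, S, hS, hT⟩ := hL.submersion_onto_image u
  set D : TangentSpace (IC E) (legendre L u) →ₗ[ℝ] E × (E →L[ℝ] ℝ) :=
    (mfderiv (IC E) 𝓘(ℝ, E × (E →L[ℝ] ℝ)) (φ.extend (IC E)) (legendre L u)).toLinearMap with hD
  obtain ⟨hinj, hsurj⟩ := mfderiv_extend_bijective (I := IC E) hφ hu
  have hrange : (LinearMap.range (pushL L u)).map D = S := by
    ext y
    constructor
    · rintro ⟨ξ, hξ, rfl⟩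
      exact (hT ξ).1 hξ
    · intro hy
      obtain ⟨ξ, rfl⟩ := hsurj y
      exact ⟨ξ, (hT ξ).2 hy, rfl⟩
  have hdimS : Module.finrank ℝ S + N₀ = Module.finrank ℝ (E × (E →L[ℝ] ℝ)) := by
    rw [← hrange, ← (Submodule.equivMapOfInjective D hinj _).finrank_eq]
    exact finrank_range_pushL hL u
  obtain ⟨β, hβ, hβS⟩ := exists_linearIndependent_annihilator hdimS
  refine ⟨φ.source, fun n s => β n (φ.extend (IC E) s), hu, φ.open_source, ?_, ?_, ?_⟩
  · intro n
    exact (β n).contMDiff.comp_contMDiffOn (φ.contMDiffOn_extend hφ)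
  · rintro n s ⟨hs, hsφ⟩
    exact hβS n _ ((hS s hsφ).1 hs)
  · rintro s ⟨-, hsφ⟩
    refine linearIndependent_of_surjective hβ
      (mfderiv_extend_bijective (I := IC E) hφ hsφ).2 fun n ξ => ?_
    have h1 := (φ.contMDiffAt_extend hφ hsφ).mdifferentiableAt (by simp)
    have h2 := mfderiv_comp s (β n).mdifferentiableAt h1
    rw [mfderiv_eq_fderiv, (β n).fderiv] at h2
    exact congrArg (fun f => f ξ) h2

end SingularLagrangian

/-! ### Flows along the fibres; projectable fields belong to `barT`. -/

namespace SingularLagrangian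
variable {E : Type*} [NormedAddCommGroup E] [NormedSpace ℝ E]
  {Q : Type*} [TopologicalSpace Q] [ChartedSpace E Q] [IsManifold 𝓘(ℝ, E) ∞ Q]
  {L : PL E Q → ℝ} {N₀ : ℕ}

lemma hasDerivAt_comp_of_hasMFDerivAt {F : Type*} [NormedAddCommGroup F] [NormedSpace ℝ F]
    {H : Type*} [TopologicalSpace H] {I : ModelWithCorners ℝ F H}
    {M : Type*} [TopologicalSpace M] [ChartedSpace H M]
    {F' : Type*} [NormedAddCommGroup F'] [NormedSpace ℝ F'] {k : M → F'}
    {c : ℝ → M} {t : ℝ} {X : ∀ x : M, TangentSpace I x}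
    (hk : MDifferentiableAt I 𝓘(ℝ, F') k (c t))
    (hc : HasMFDerivAt 𝓘(ℝ, ℝ) I c t ((1 : ℝ →L[ℝ] ℝ).smulRight (X (c t)))) :
    HasDerivAt (k ∘ c) (dAlong I k X (c t)) t := by
  have h1 : HasFDerivAt (k ∘ c) (show ℝ →L[ℝ] F' from
      (mfderiv I 𝓘(ℝ, F') k (c t)).comp ((1 : ℝ →L[ℝ] ℝ).smulRight (X (c t)))) t :=
    (hk.hasMFDerivAt.comp t hc).hasFDerivAt
  have h2 : ((1 : ℝ) • X (c t)) = X (c t) := one_smul _ _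
  have h3 := congrArg (mfderiv I 𝓘(ℝ, F') k (c t)) h2
  exact h1.hasDerivAt.congr_deriv h3

lemma eventually_proj_mem (u₀ : PL E Q) {u : PL E Q} (hu : u.proj ∈ (chartAt E u₀.proj).source) :
    ∀ᶠ w : PL E Q in 𝓝 u, w.proj ∈ (chartAt E u₀.proj).source :=
  (FiberBundle.continuous_proj E (TangentSpace 𝓘(ℝ, E))).continuousAt.eventually_mem
    ((chartAt E u₀.proj).open_source.mem_nhds hu)

lemma dAlong_chart_legendre (hL : ContMDiff (IL E) 𝓘(ℝ, ℝ) ∞ L) {u₀ u : PL E Q}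
    (hu : u.proj ∈ (chartAt E u₀.proj).source) (X : Field E Q) :
    dAlong (IL E) (extChartAt (IC E) (legendre L u₀) ∘ legendre L) X u =
      dChC (legendre L u₀) (legendre L u) (dLegendre L u (X u)) := by
  have h1 := mfderiv_comp u (I' := IC E) (g := extChartAt (IC E) (legendre L u₀))
    (f := legendre L) (mdifferentiableAt_extChartAt_of_mem (legendre_mem_source hu))
    ((contMDiff_legendre hL).mdifferentiable (by simp) u)
  exact congrArg (fun f => f (X u)) h1

/-- Integral curves of fields annihilated by the pushforward stay in the fibres of the fibre
derivative. -/
lemma eventually_legendre_eq (hL : ContMDiff (IL E) 𝓘(ℝ, ℝ) ∞ L) {G : Field E Q}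
    (hG : ∀ u, dLegendre L u (G u) = 0) {c : ℝ → PL E Q}
    (hc : IsMIntegralCurveAt (I := IL E) c G 0) :
    ∀ᶠ t in 𝓝 (0 : ℝ), legendre L (c t) = legendre L (c 0) := by
  set u₀ := c 0 with hu₀
  set f := extChartAt (IC E) (legendre L u₀) ∘ legendre L with hf
  have hmem : ∀ᶠ t in 𝓝 (0 : ℝ), (c t).proj ∈ (chartAt E u₀.proj).source :=
    hc.continuousAt.eventually (eventually_proj_mem u₀ (mem_chart_source E u₀.proj))
  have hder : ∀ᶠ t in 𝓝 (0 : ℝ), (c t).proj ∈ (chartAt E u₀.proj).source ∧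
      HasDerivAt (f ∘ c) 0 t := by
    filter_upwards [hmem, hc] with t ht hct
    refine ⟨ht, ?_⟩
    have hfd : MDifferentiableAt (IL E) 𝓘(ℝ, E × (E →L[ℝ] ℝ)) f (c t) :=
      (mdifferentiableAt_extChartAt_of_mem (legendre_mem_source ht)).comp (c t)
        ((contMDiff_legendre hL).mdifferentiable (by simp) (c t))
    have h2 := dAlong_chart_legendre hL ht G
    rw [hG, ContinuousLinearMap.map_zero] at h2
    exact h2 ▸ hasDerivAt_comp_of_hasMFDerivAt hfd hct
  obtain ⟨ε, hε, hball⟩ := Metric.eventually_nhds_iff_ball.1 hder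
  filter_upwards [Metric.ball_mem_nhds (0 : ℝ) hε] with t ht
  have h1 : f (c t) = f (c 0) := by
    refine Metric.isOpen_ball.is_const_of_deriv_eq_zero (convex_ball (0 : ℝ) ε).isPreconnected
      (f := f ∘ c) (fun t ht => (hball t ht).2.differentiableAt.differentiableWithinAt)
      (fun t ht => (hball t ht).2.deriv) ht (Metric.mem_ball_self hε)
  exact (extChartAt (IC E) (legendre L u₀)).injOn (legendre_mem_source (hball t ht).1)
    (legendre_mem_source (mem_chart_source E u₀.proj)) h1

variable [FiniteDimensional ℝ E]

/-- The integral curve of `G` through `u₀` stays in one fibre, where `k` is locally constant; its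
velocity at the start is `G u₀`. -/
lemma mfderiv_eq_zero_of_fibre_const (hL : ContMDiff (IL E) 𝓘(ℝ, ℝ) ∞ L) {G : Field E Q}
    (hGs : IsSmooth G) (hG : ∀ u, dLegendre L u (G u) = 0) {F : Type*} [NormedAddCommGroup F]
    [NormedSpace ℝ F] {k : PL E Q → F} {u₀ : PL E Q}
    (hk : ∀ᶠ u in 𝓝 u₀, legendre L u = legendre L u₀ → k u = k u₀) :
    dAlong (IL E) k G u₀ = 0 := by
  have : CompleteSpace (E × E) := FiniteDimensional.complete ℝ _
  by_cases hd : MDifferentiableAt (IL E) 𝓘(ℝ, F) k u₀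
  · obtain ⟨c, hc0, hc⟩ := exists_isMIntegralCurveAt_of_contMDiffAt_boundaryless (I := IL E)
      (v := G) (x₀ := u₀) 0 ((hGs.of_le (m := 1) (by simp)) u₀)
    have h1 := eventually_legendre_eq hL hG hc
    subst hc0
    have h2 : ∀ᶠ t in 𝓝 (0 : ℝ), k (c t) = k (c 0) := by
      filter_upwards [h1, hc.continuousAt.eventually hk] with t ht hkt
      exact hkt ht
    exact (hasDerivAt_comp_of_hasMFDerivAt hd hc.hasMFDerivAt).unique
      ((hasDerivAt_const (0 : ℝ) (k (c 0))).congr_of_eventuallyEq h2)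
  -- At a point of non-differentiability `mfderiv` is zero by convention, so no regularity of `k`
  -- has to be assumed.
  · unfold dAlong
    rw [mfderiv_zero_of_not_mdifferentiableAt hd]
    rfl

lemma IsSmooth.bracket {X Y : Field E Q} (hX : IsSmooth X) (hY : IsSmooth Y) :
    IsSmooth (bracket X Y) := by
  have : CompleteSpace (E × E) := FiniteDimensional.complete ℝ _
  have : IsManifold (IL E) (((⊤ : ℕ∞) : ℕ∞ω) + 1) (PL E Q) :=
    inferInstanceAs (IsManifold (IL E) ∞ (PL E Q))
  have : IsManifold (IL E) (minSmoothness ℝ 3) (PL E Q) := by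
    rw [minSmoothness_of_isRCLikeNormedField]
    exact IsManifold.of_le (n := ∞) ENat.LEInfty.out
  exact ContDiff.mlieBracket_vectorField (n := ⊤) (m := ⊤) hX hY (by simp)

lemma mem_vertKer_iff (hL : ContMDiff (IL E) 𝓘(ℝ, ℝ) ∞ L) {G : Field E Q} :
    G ∈ vertKer L ↔ IsSmooth G ∧ ∀ u, dLegendre L u (G u) = 0 := by
  simp only [dLegendre_eq_zero_iff hL]
  exact ⟨fun h => ⟨h.1, fun u => ⟨h.2.1 u, h.2.2 u⟩⟩,
    fun h => ⟨h.1, fun u => (h.2 u).1, fun u => (h.2 u).2⟩⟩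

/-- With `f` the fibre derivative in a chart of `T^*Q`, the bracket acts on `f` as `X (G f) - G (X
f)`. Here `G f` vanishes near `u₀`, and `X f` is the pushforward of `X` in coordinates, constant on
fibres by projectability. -/
lemma IsProjectable.mem_barT (hL : ContMDiff (IL E) 𝓘(ℝ, ℝ) ∞ L) {X : Field E Q}
    (hXs : IsSmooth X) (hX : IsProjectable L X) : X ∈ barT L := by
  refine ⟨hXs, fun G hG => ?_⟩
  rw [mem_vertKer_iff hL] at hG ⊢
  refine ⟨hXs.bracket hG.1, fun u₀ => ?_⟩
  have : CompleteSpace (E × E) := FiniteDimensional.complete ℝ _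
  have hu₀ := mem_chart_source E u₀.proj
  apply (isInvertible_dChC (s₀ := legendre L u₀) (s := legendre L u₀) hu₀).injective
  rw [ContinuousLinearMap.map_zero, ← dAlong_chart_legendre hL hu₀]
  set f := extChartAt (IC E) (legendre L u₀) ∘ legendre L with hf
  have hfs : ContMDiffAt (IL E) 𝓘(ℝ, E × (E →L[ℝ] ℝ)) 2 f u₀ :=
    (contMDiffAt_extChartAt (n := 2)).comp u₀
      ((contMDiff_legendre hL u₀).of_le ENat.LEInfty.out)
  have h1 : dAlong (IL E) f G =ᶠ[𝓝 u₀] fun _ => 0 := by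
    filter_upwards [eventually_proj_mem u₀ hu₀] with u hu
    rw [hf, dAlong_chart_legendre hL hu, hG.2, ContinuousLinearMap.map_zero]
  have h2 : dAlong (IL E) (dAlong (IL E) f G) X u₀ = 0 := by
    have h3 : mfderiv (IL E) 𝓘(ℝ, E × (E →L[ℝ] ℝ)) (dAlong (IL E) f G) u₀ =
      mfderiv (IL E) 𝓘(ℝ, E × (E →L[ℝ] ℝ)) (fun _ => (0 : E × (E →L[ℝ] ℝ))) u₀ := h1.mfderiv_eq
    rw [mfderiv_const] at h3
    exact congrArg (fun g => g (X u₀)) h3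
  have h4 : dAlong (IL E) (dAlong (IL E) f X) G u₀ = 0 := by
    refine mfderiv_eq_zero_of_fibre_const hL hG.1 hG.2 ?_
    filter_upwards [eventually_proj_mem u₀ hu₀] with u hu h
    rw [hf, dAlong_chart_legendre hL hu, dAlong_chart_legendre hL hu₀]
    exact congrArg (fun ζ : TangentBundle (IC E) (PC E Q) => dChC (legendre L u₀) ζ.1 ζ.2)
      (hX u u₀ h)
  have h5 := dAlong_mlieBracket hfs (hXs.mdiff u₀) (hG.1.mdiff u₀)
  rw [h2, h4, sub_zero] at h5
  exact h5

end SingularLagrangian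

/-! ### Lifting fields tangent to the image to projectable fields on `TQ`. -/

namespace SingularLagrangian
variable {E : Type*} [NormedAddCommGroup E] [NormedSpace ℝ E]
  {Q : Type*} [TopologicalSpace Q] [ChartedSpace E Q] [IsManifold 𝓘(ℝ, E) ∞ Q]
  {L : PL E Q → ℝ} {N₀ : ℕ} [FiniteDimensional ℝ E]

/-- In a chart, a vector field on `T^*Q` along the image that is tangent to the image has a smooth
lift through the fibre derivative. -/
lemma exists_coordinate_lift (hL : IsAlmostRegular L N₀) {u₀ : PL E Q} {W : Set (E × E)}
    (hW : IsOpen W) (hWt : W ⊆ (extChartAt (IL E) u₀).target)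
    {b : E × E → E × (E →L[ℝ] ℝ)} (hb : ContDiffOn ℝ ∞ b W)
    (htan : ∀ y ∈ W, ∃ η : E × E, (η.1, fderiv ℝ (momCoord L u₀) y η) = b y) :
    ∃ X : E × E → E × E, ContDiffOn ℝ ∞ X W ∧
      ∀ y ∈ W, ((X y).1, fderiv ℝ (momCoord L u₀) y (X y)) = b y := by
  have hD := (contDiffOn_fderiv_momCoord hL.smooth u₀).mono hWt
  have hb1 : ContDiffOn ℝ ∞ (fun y => (b y).1) W := contDiff_fst.comp_contDiffOn hb
  have hb2 : ContDiffOn ℝ ∞ (fun y => (b y).2) W := contDiff_snd.comp_contDiffOn hb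
  have hsplit : ∀ (y : E × E) (a w : E), fderiv ℝ (momCoord L u₀) y (a, w) =
      fderiv ℝ (momCoord L u₀) y (a, 0) + hessCoord L u₀ y w := by
    intro y a w
    have h1 : ((a, w) : E × E) = (a, 0) + (0, w) := by simp
    rw [h1, ContinuousLinearMap.map_add]
    rfl
  -- The base component of the lift is forced to be that of `b`. Subtracting its contribution to the
  -- momentum component leaves the system `M w = c` for the fibre component.
  have hc : ContDiffOn ℝ ∞
      (fun y => (b y).2 - fderiv ℝ (momCoord L u₀) y ((b y).1, 0)) W :=
    hb2.sub (hD.clm_apply (hb1.prodMk contDiffOn_const))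
  obtain ⟨w, hw, hwc⟩ := exists_contDiffOn_solution_of_symmetric hW (N := N₀)
    ((contDiffOn_hessCoord hL.smooth u₀).mono hWt) hc
    (fun y hy => hessCoord_symm hL.smooth (hWt hy))
    (fun y hy => by
      have h1 := mem_extChartAt_PL_source.1 ((extChartAt (IL E) u₀).map_target (hWt hy))
      have h2 := finrank_ker_hessCoord hL.smooth h1
      rwa [(extChartAt (IL E) u₀).right_inv (hWt hy), hL.nullity] at h2)
    (fun y hy => by
      obtain ⟨⟨a, v⟩, hη⟩ := htan y hy
      refine ⟨v, ?_⟩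
      rw [← hη, hsplit]
      simp)
  refine ⟨fun y => ((b y).1, w y), hb1.prodMk hw, fun y hy => ?_⟩
  refine Prod.ext rfl ?_
  change fderiv ℝ (momCoord L u₀) y ((b y).1, w y) = (b y).2
  rw [hsplit, hwc y hy]
  abel

instance [T2Space Q] : T2Space (PC E Q) := t2Space_totalSpace _

/-- A smooth field along the image of the fibre derivative and tangent to it near a point is, up to
a bump function, the pushforward of a smooth projectable field. -/
lemma exists_lift [T2Space Q] (hL : IsAlmostRegular L N₀) (u₀ : PL E Q)
    {O : Set (E × (E →L[ℝ] ℝ))} (hO : O ∈ 𝓝 (extChartAt (IC E) (legendre L u₀) (legendre L u₀)))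
    {Y : E × (E →L[ℝ] ℝ) → E × (E →L[ℝ] ℝ)} (hY : ContDiffOn ℝ ∞ Y O)
    (htan : ∀ u : PL E Q, u.proj ∈ (chartAt E u₀.proj).source →
      extChartAt (IC E) (legendre L u₀) (legendre L u) ∈ O →
      ∃ η, dChC (legendre L u₀) (legendre L u) (dLegendre L u η) =
        Y (extChartAt (IC E) (legendre L u₀) (legendre L u))) :
    ∃ (X : Field E Q) (f : PC E Q → ℝ), IsSmooth X ∧ f (legendre L u₀) = 1 ∧
      (∀ s, f s ≠ 0 → s.proj ∈ (chartAt E u₀.proj).source ∧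
        extChartAt (IC E) (legendre L u₀) s ∈ O) ∧
      (∀ u, f (legendre L u) = 0 → X u = 0) ∧
      ∀ u, f (legendre L u) ≠ 0 →
        dChC (legendre L u₀) (legendre L u) (dLegendre L u (X u)) =
          f (legendre L u) • Y (extChartAt (IC E) (legendre L u₀) (legendre L u)) := by
  set s₀ := legendre L u₀ with hs₀
  set O' := interior O with hO'
  have hO'mem : extChartAt (IC E) s₀ s₀ ∈ O' := mem_interior_iff_mem_nhds.2 hO
  -- The full preimage of `O'` in the chart domain, not just a neighbourhood of `u₀`: the lift must
  -- exist wherever the pulled-back cutoff can be nonzero.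
  set W : Set (E × E) := (extChartAt (IL E) u₀).target ∩ legCoord L u₀ ⁻¹' O' with hWdef
  have hlegcont := (contDiffOn_legCoord hL.smooth u₀).continuousOn
  have hW : IsOpen W :=
    hlegcont.isOpen_inter_preimage (isOpen_extChartAt_target u₀) isOpen_interior
  have hWt : W ⊆ (extChartAt (IL E) u₀).target := inter_subset_left
  have hb : ContDiffOn ℝ ∞ (fun y => Y (legCoord L u₀ y)) W :=
    hY.comp ((contDiffOn_legCoord hL.smooth u₀).mono hWt) fun y hy => interior_subset hy.2
  have hchart : ∀ u : PL E Q, u.proj ∈ (chartAt E u₀.proj).source →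
      extChartAt (IC E) s₀ (legendre L u) = legCoord L u₀ (extChartAt (IL E) u₀ u) :=
    fun u hu => extChartAt_legendre hL.smooth hu
  obtain ⟨X', hX', hXb⟩ := exists_coordinate_lift hL hW hWt hb (fun y hy => by
    have hsrc := (extChartAt (IL E) u₀).map_target (hWt hy)
    have hu := mem_extChartAt_PL_source.1 hsrc
    have hinv := (extChartAt (IL E) u₀).right_inv (hWt hy)
    have h1 := hchart _ hu
    rw [hinv] at h1
    obtain ⟨η, hη⟩ := htan _ hu (by rw [h1]; exact interior_subset hy.2)
    rw [h1, dChC_dLegendre hL.smooth hu, hinv] at hη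
    exact ⟨_, hη⟩)
  set U : Set (PL E Q) := (extChartAt (IL E) u₀).source ∩ extChartAt (IL E) u₀ ⁻¹' W with hU
  have hUopen : IsOpen U := isOpen_extChartAt_preimage' u₀ hW
  let Z : Field E Q := VectorField.mpullback (IL E) 𝓘(ℝ, E × E) (extChartAt (IL E) u₀) X'
  have hZapply : ∀ u : PL E Q, u.proj ∈ (chartAt E u₀.proj).source →
      dChL u₀ u (Z u) = X' (extChartAt (IL E) u₀ u) := by
    intro u hu
    exact (isInvertible_dChL hu).self_apply_inverse _
  have hZ : ContMDiffOn (IL E) (IL E).tangent ∞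
      (fun u => (⟨u, Z u⟩ : TangentBundle (IL E) (PL E Q))) U := by
    intro u hu
    have : CompleteSpace (E × E) := FiniteDimensional.complete ℝ _
    have hu' := mem_extChartAt_PL_source.1 hu.1
    refine (ContMDiffAt.mpullback_vectorField_preimage (n := ∞) (m := ∞) ?_ ?_
      (isInvertible_dChL hu') (by simp)).contMDiffWithinAt
    · exact contMDiffAt_vectorSpace_iff_contDiffAt.2 (hX'.contDiffAt (hW.mem_nhds hu.2))
    · exact contMDiffAt_extChartAt' (by have h := hu.1; rwa [extChartAt_source] at h)
  have hnhds : {s : PC E Q | s ∈ (extChartAt (IC E) s₀).source ∧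
      extChartAt (IC E) s₀ s ∈ O'} ∈ 𝓝 s₀ :=
    Filter.inter_mem (extChartAt_source_mem_nhds s₀)
      ((continuousAt_extChartAt s₀).preimage_mem_nhds (isOpen_interior.mem_nhds hO'mem))
  -- The bump function lives on `T^*Q`, so `f ∘ ℒ` is constant on the fibres and multiplication by
  -- it preserves projectability.
  obtain ⟨f, -, hf⟩ := (SmoothBumpFunction.nhds_basis_tsupport (I := IC E) s₀).mem_iff.1 hnhds
  have hfl : ContMDiff (IL E) 𝓘(ℝ, ℝ) ∞ (f ∘ legendre L) :=
    f.contMDiff.comp (contMDiff_legendre hL.smooth)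
  have hsupp : tsupport (f ∘ legendre L) ⊆ U := by
    have h1 : tsupport (f ∘ legendre L) ⊆ legendre L ⁻¹' tsupport f :=
      closure_minimal (fun u hu => subset_closure hu)
        ((isClosed_tsupport f).preimage (contMDiff_legendre hL.smooth).continuous)
    intro u hu
    obtain ⟨h2, h3⟩ := hf (h1 hu)
    have h4 : u.proj ∈ (chartAt E u₀.proj).source :=
      (mem_extChartAt_PC_source (s₀ := s₀) (s := legendre L u)).1 h2
    have h5 := mem_extChartAt_PL_source.2 h4
    refine ⟨h5, (extChartAt (IL E) u₀).map_source h5, ?_⟩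
    rw [mem_preimage, ← hchart u h4]
    exact h3
  have hf' : ∀ s, f s ≠ 0 → s.proj ∈ (chartAt E u₀.proj).source ∧
      extChartAt (IC E) s₀ s ∈ O' := fun s hs => by
    obtain ⟨h1, h2⟩ := hf (subset_closure hs)
    exact ⟨(mem_extChartAt_PC_source (s₀ := s₀) (s := s)).1 h1, h2⟩
  refine ⟨(f ∘ legendre L) • Z, f, ?_, f.eq_one, ?_, ?_, ?_⟩
  · exact ContMDiffOn.smul_section_of_tsupport (V := (TangentSpace (IL E) : PL E Q → Type _))
      hfl.contMDiffOn hUopen hsupp hZ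
  · exact fun s hs => ⟨(hf' s hs).1, interior_subset (hf' s hs).2⟩
  · intro u hu
    change f (legendre L u) • Z u = 0
    rw [hu, zero_smul]
  · intro u hu
    obtain ⟨h1, h2⟩ := hf' _ hu
    have h1' : u.proj ∈ (chartAt E u₀.proj).source := h1
    have h3 : extChartAt (IL E) u₀ u ∈ W := by
      refine ⟨(extChartAt (IL E) u₀).map_source (mem_extChartAt_PL_source.2 h1'), ?_⟩
      rw [mem_preimage, ← hchart u h1']
      exact h2
    change dChC s₀ (legendre L u) (dLegendre L u (f (legendre L u) • Z u)) = _
    rw [ContinuousLinearMap.map_smul, ContinuousLinearMap.map_smul]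
    have h4 := dChC_dLegendre hL.smooth h1' (Z u)
    rw [hZapply u h1', hXb _ h3, ← hchart u h1'] at h4
    exact congrArg (fun a => f (legendre L u) • a) h4

/-- The lifts of `exists_lift` are projectable. -/
lemma isProjectable_of_lift {u₀ : PL E Q} {X : Field E Q} {f : PC E Q → ℝ}
    {Y : E × (E →L[ℝ] ℝ) → E × (E →L[ℝ] ℝ)}
    (hf : ∀ s, f s ≠ 0 → s.proj ∈ (chartAt E u₀.proj).source)
    (h0 : ∀ u, f (legendre L u) = 0 → X u = 0)
    (hX : ∀ u, f (legendre L u) ≠ 0 →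
      dChC (legendre L u₀) (legendre L u) (dLegendre L u (X u)) =
        f (legendre L u) • Y (extChartAt (IC E) (legendre L u₀) (legendre L u))) :
    IsProjectable L X := by
  have hzero : ∀ s s' : PC E Q, s = s' → (⟨s, 0⟩ : TangentBundle (IC E) (PC E Q)) = ⟨s', 0⟩ := by
    rintro s _ rfl
    rfl
  have hinj : ∀ (s s' : PC E Q) (a : TangentSpace (IC E) s) (a' : TangentSpace (IC E) s'),
      s = s' → s.proj ∈ (chartAt E (legendre L u₀).proj).source →
      dChC (legendre L u₀) s a = dChC (legendre L u₀) s' a' →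
      (⟨s, a⟩ : TangentBundle (IC E) (PC E Q)) = ⟨s', a'⟩ := by
    rintro s _ a a' rfl hs h
    rw [(isInvertible_dChC hs).injective h]
  intro u u' huu
  by_cases h : f (legendre L u) = 0
  · rw [h0 u h, h0 u' (huu ▸ h), ContinuousLinearMap.map_zero, ContinuousLinearMap.map_zero]
    exact hzero _ _ huu
  · refine hinj _ _ _ _ huu (hf _ h) ?_
    rw [hX u h, hX u' (huu ▸ h), huu]

end SingularLagrangian

/-! ### Local fields tangent to level sets and local Hamiltonian fields. -/

namespace SingularLagrangian

section Fields

variable {F G : Type*} [NormedAddCommGroup F] [NormedSpace ℝ F] [FiniteDimensional ℝ F]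
  [NormedAddCommGroup G] [NormedSpace ℝ G] [FiniteDimensional ℝ G] {N : ℕ}

/-- The field is the projection of `ξ` onto `ker (Γ x)` along the range of a fixed right inverse `R`
of `Γ x₀`. This makes sense as long as `Γ x ∘ R` is invertible, an open condition that holds at
`x₀`. -/
lemma exists_contDiffOn_mem_ker {U : Set F} (hU : IsOpen U) {Γ : F → F →L[ℝ] G} {x₀ : F}
    (hx₀ : x₀ ∈ U) (hΓ : ContDiffOn ℝ ∞ Γ U)
    (hsurj : Function.Surjective (Γ x₀)) {ξ : F} (hξ : Γ x₀ ξ = 0) :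
    ∃ O ∈ 𝓝 x₀, O ⊆ U ∧ ∃ Y : F → F, ContDiffOn ℝ ∞ Y O ∧ Y x₀ = ξ ∧
      ∀ x ∈ O, Γ x (Y x) = 0 := by
  obtain ⟨R', hR'⟩ := LinearMap.exists_rightInverse_of_surjective (Γ x₀ : F →ₗ[ℝ] G)
    (LinearMap.range_eq_top.2 hsurj)
  set R : G →L[ℝ] F := LinearMap.toContinuousLinearMap R' with hR
  set B : F → G →L[ℝ] G := fun x => (Γ x).comp R with hB
  have hB0 : B x₀ = ContinuousLinearMap.id ℝ G := by
    ext k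
    exact congrArg (fun f => f k) hR'
  have hBd : ContDiffOn ℝ ∞ B U := hΓ.clm_comp contDiffOn_const
  have : CompleteSpace G := FiniteDimensional.complete ℝ G
  set O : Set F := U ∩ B ⁻¹' range ((↑) : (G ≃L[ℝ] G) → G →L[ℝ] G) with hO
  have hOo : IsOpen O :=
    hBd.continuousOn.isOpen_inter_preimage hU ContinuousLinearEquiv.isOpen
  refine ⟨O, hOo.mem_nhds ⟨hx₀, ContinuousLinearEquiv.refl ℝ G, hB0.symm⟩, inter_subset_left,
    fun x => ξ - R (ContinuousLinearMap.inverse (B x) (Γ x ξ)), ?_, ?_, ?_⟩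
  · have hinv : ContDiffOn ℝ ∞ (fun x => ContinuousLinearMap.inverse (B x)) O := by
      rintro x ⟨hxU, e, he⟩
      refine (ContDiffAt.comp x (g := ContinuousLinearMap.inverse) ?_
        (hBd.contDiffAt (hU.mem_nhds hxU))).contDiffWithinAt
      rw [← he]
      exact contDiffAt_map_inverse e
    exact contDiffOn_const.sub (contDiffOn_const.clm_apply
      (hinv.clm_apply ((hΓ.mono inter_subset_left).clm_apply contDiffOn_const)))
  · simp [hξ]
  · rintro x ⟨-, e, he⟩
    have h1 : Γ x (R (ContinuousLinearMap.inverse (B x) (Γ x ξ))) =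
        B x (ContinuousLinearMap.inverse (B x) (Γ x ξ)) := rfl
    rw [map_sub, h1, ← he, ContinuousLinearMap.inverse_equiv]
    simp

lemma surjective_pi_of_linearIndependent {f : Fin N → F →L[ℝ] ℝ} (hf : LinearIndependent ℝ f) :
    Function.Surjective (ContinuousLinearMap.pi f) := by
  let T : (F →L[ℝ] ℝ) →ₗ[ℝ] F → ℝ :=
    { toFun := fun φ => φ, map_add' := fun _ _ => rfl, map_smul' := fun _ _ => rfl }
  have h1 : LinearIndependent ℝ (fun n => (f n : F → ℝ)) :=
    hf.map' T (LinearMap.ker_eq_bot.2 DFunLike.coe_injective)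
  have h2 := span_flip_eq_top_iff_linearIndependent.2 h1
  have h3 : (LinearMap.range (ContinuousLinearMap.pi f : F →ₗ[ℝ] Fin N → ℝ)) = ⊤ := by
    rw [eq_top_iff, ← h2, Submodule.span_le]
    rintro _ ⟨v, rfl⟩
    exact ⟨v, rfl⟩
  exact LinearMap.range_eq_top.1 h3

/-- A vector tangent to a level set extends to a smooth field tangent to the nearby level sets. -/
lemma exists_contDiffOn_tangent {U : Set F} (hU : IsOpen U) {g : Fin N → F → ℝ} {x₀ : F}
    (hx₀ : x₀ ∈ U) (hg : ∀ n, ContDiffOn ℝ ∞ (g n) U)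
    (hli : LinearIndependent ℝ (fun n => fderiv ℝ (g n) x₀)) {ξ : F}
    (hξ : ∀ n, fderiv ℝ (g n) x₀ ξ = 0) :
    ∃ O ∈ 𝓝 x₀, O ⊆ U ∧ ∃ Y : F → F, ContDiffOn ℝ ∞ Y O ∧ Y x₀ = ξ ∧
      ∀ x ∈ O, ∀ n, fderiv ℝ (g n) x (Y x) = 0 := by
  have hG : ContDiffOn ℝ ∞ (fun x n => g n x) U := contDiffOn_pi.2 hg
  have hΓ : ∀ x ∈ U, fderiv ℝ (fun x n => g n x) x =
      ContinuousLinearMap.pi fun n => fderiv ℝ (g n) x := fun x hx =>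
    fderiv_pi fun n => ((hg n).contDiffAt (hU.mem_nhds hx)).differentiableAt (by simp)
  obtain ⟨O, hO, hOU, Y, hY, hY0, h⟩ := exists_contDiffOn_mem_ker hU hx₀
    (hG.fderiv_of_isOpen (m := ∞) hU (by simp))
    (by rw [hΓ x₀ hx₀]; exact surjective_pi_of_linearIndependent hli) (ξ := ξ)
    (by rw [hΓ x₀ hx₀]; exact funext hξ)
  refine ⟨O, hO, hOU, Y, hY, hY0, fun x hx n => ?_⟩
  have h1 := h x hx
  rw [hΓ x (hOU hx)] at h1
  exact congrFun h1 n

lemma contDiffOn_sum_smul_fderiv {U : Set F} (hU : IsOpen U) {g : Fin N → F → ℝ}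
    (hg : ∀ n, ContDiffOn ℝ ∞ (g n) U) (c : Fin N → ℝ) (J : (F →L[ℝ] ℝ) →L[ℝ] G) :
    ContDiffOn ℝ ∞ (fun y => ∑ n, c n • J (fderiv ℝ (g n) y)) U :=
  ContDiffOn.sum fun n _ => ContDiffOn.const_smul (c n)
    (contDiffOn_const.clm_apply ((hg n).fderiv_of_isOpen (m := ∞) hU (by simp)))

variable {E : Type*} [NormedAddCommGroup E] [NormedSpace ℝ E] [FiniteDimensional ℝ E]

/-- The Hamiltonian vector field of a linear combination of functions. -/
lemma exists_contDiffOn_hamiltonian {U : Set (E × (E →L[ℝ] ℝ))} (hU : IsOpen U)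
    {g : Fin N → E × (E →L[ℝ] ℝ) → ℝ} (hg : ∀ n, ContDiffOn ℝ ∞ (g n) U) (c : Fin N → ℝ) :
    ∃ Y : E × (E →L[ℝ] ℝ) → E × (E →L[ℝ] ℝ), ContDiffOn ℝ ∞ Y U ∧
      ∀ y η, η.2 (Y y).1 - (Y y).2 η.1 = ∑ n, c n * fderiv ℝ (g n) y η := by
  obtain ⟨J, hJ⟩ := exists_inverse_of_canonical_pairing (E := E)
  refine ⟨_, contDiffOn_sum_smul_fderiv hU hg c J, fun y η => ?_⟩
  simp only [Prod.fst_sum, Prod.snd_sum, Prod.smul_fst, Prod.smul_snd, map_sum, map_smul,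
    sum_apply, smul_apply, ← Finset.sum_sub_distrib, ← hJ, smul_eq_mul, mul_sub]

end Fields

end SingularLagrangian

/-! ### The pushforward of `barT`, the description of `Prim^♭`, and integral curves. -/

namespace SingularLagrangian
variable {E : Type*} [NormedAddCommGroup E] [NormedSpace ℝ E]
  {Q : Type*} [TopologicalSpace Q] [ChartedSpace E Q] [IsManifold 𝓘(ℝ, E) ∞ Q]
  {L : PL E Q → ℝ} {N₀ : ℕ} [FiniteDimensional ℝ E]
  {V : Set (PC E Q)} {γ : Fin N₀ → PC E Q → ℝ}

lemma dC_eq_fderiv {s₀ s : PC E Q} (hs : s.proj ∈ (chartAt E s₀.proj).source) {g : PC E Q → ℝ}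
    (hg : MDifferentiableAt (IC E) 𝓘(ℝ, ℝ) g s) (ζ : TangentSpace (IC E) s) :
    dC g s ζ = fderiv ℝ (g ∘ (extChartAt (IC E) s₀).symm) (extChartAt (IC E) s₀ s)
      (dChC s₀ s ζ) := by
  have hss := mem_extChartAt_PC_source.2 hs
  have hst := (extChartAt (IC E) s₀).map_source hss
  have hinv := (extChartAt (IC E) s₀).left_inv hss
  have h1 : (g ∘ (extChartAt (IC E) s₀).symm) ∘ extChartAt (IC E) s₀ =ᶠ[𝓝 s] g := by
    filter_upwards [(isOpen_extChartAt_source s₀).mem_nhds hss] with r hr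
    exact congrArg g ((extChartAt (IC E) s₀).left_inv hr)
  have hd : MDifferentiableAt 𝓘(ℝ, E × (E →L[ℝ] ℝ)) 𝓘(ℝ, ℝ)
      (g ∘ (extChartAt (IC E) s₀).symm) (extChartAt (IC E) s₀ s) :=
    MDifferentiableAt.comp (extChartAt (IC E) s₀ s) (g := g) (by rw [hinv]; exact hg)
      (mdifferentiableAt_extChartAt_symm hst)
  have h2 := mfderiv_comp s hd (mdifferentiableAt_extChartAt_of_mem hss)
  rw [mfderiv_eq_fderiv] at h2
  have h3 : mfderiv (IC E) 𝓘(ℝ, ℝ) ((g ∘ (extChartAt (IC E) s₀).symm) ∘ extChartAt (IC E) s₀) s =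
    mfderiv (IC E) 𝓘(ℝ, ℝ) g s := h1.mfderiv_eq
  exact congrArg (fun f => f ζ) (h3.symm.trans h2)

lemma IsPrimaryConstraints.isOpen_chart (hγ : IsPrimaryConstraints L V γ) (s₀ : PC E Q) :
    IsOpen ((extChartAt (IC E) s₀).target ∩ (extChartAt (IC E) s₀).symm ⁻¹' V) :=
  (contMDiffOn_extChartAt_symm (n := ∞) s₀).continuousOn.isOpen_inter_preimage
    (isOpen_extChartAt_target s₀) hγ.isOpen

lemma IsPrimaryConstraints.contDiffOn_chart (hγ : IsPrimaryConstraints L V γ) (s₀ : PC E Q)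
    (n : Fin N₀) : ContDiffOn ℝ ∞ (γ n ∘ (extChartAt (IC E) s₀).symm)
      ((extChartAt (IC E) s₀).target ∩ (extChartAt (IC E) s₀).symm ⁻¹' V) :=
  ((hγ.smooth n).comp ((contMDiffOn_extChartAt_symm s₀).mono inter_subset_left)
    fun _ hy => hy.2).contDiffOn

lemma IsPrimaryConstraints.mem_chart {s₀ s : PC E Q}
    (hs : s.proj ∈ (chartAt E s₀.proj).source) (hV : s ∈ V) :
    extChartAt (IC E) s₀ s ∈
      (extChartAt (IC E) s₀).target ∩ (extChartAt (IC E) s₀).symm ⁻¹' V := by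
  have hss := mem_extChartAt_PC_source.2 hs
  refine ⟨(extChartAt (IC E) s₀).map_source hss, ?_⟩
  rwa [mem_preimage, (extChartAt (IC E) s₀).left_inv hss]

lemma mem_of_chart_mem {s₀ s : PC E Q} (hs : s.proj ∈ (chartAt E s₀.proj).source)
    (h : (extChartAt (IC E) s₀).symm (extChartAt (IC E) s₀ s) ∈ V) : s ∈ V := by
  rwa [(extChartAt (IC E) s₀).left_inv (mem_extChartAt_PC_source.2 hs)] at h

/-- Every vector tangent to the primary constraint submanifold is the pushforward of the value of
a projectable field. -/
lemma exists_mem_barT_dLegendre_eq [T2Space Q] (hL : IsAlmostRegular L N₀)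
    (hγ : IsPrimaryConstraints L V γ) {u₀ : PL E Q} (hu₀ : legendre L u₀ ∈ V)
    {ξ : TangentSpace (IC E) (legendre L u₀)} (hξ : ξ ∈ primaryTangent γ (legendre L u₀)) :
    ∃ X ∈ barT L, dLegendre L u₀ (X u₀) = ξ := by
  have hs₀ : (legendre L u₀).proj ∈ (chartAt E (legendre L u₀).proj).source :=
    mem_chart_source E u₀.proj
  have hdC : ∀ n (ζ : TangentSpace (IC E) (legendre L u₀)), _ := fun n ζ =>
    dC_eq_fderiv (s₀ := legendre L u₀) hs₀ (hγ.mdifferentiableAt n hu₀) ζ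
  obtain ⟨O, hO, hOU, Y, hY, hY0, hYt⟩ := exists_contDiffOn_tangent
    (hγ.isOpen_chart (legendre L u₀)) (IsPrimaryConstraints.mem_chart hs₀ hu₀)
    (hγ.contDiffOn_chart (legendre L u₀))
    (by
      obtain ⟨e, he⟩ := isInvertible_dChC (s₀ := legendre L u₀) (s := legendre L u₀) hs₀
      refine linearIndependent_of_surjective (hγ.independent _ ⟨mem_range_self u₀, hu₀⟩)
        e.symm.surjective fun n y => ?_
      have h1 := hdC n (e.symm y)
      have h2 : dChC (legendre L u₀) (legendre L u₀) (e.symm y) = y := by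
        rw [← he]
        exact e.apply_symm_apply y
      rw [h2] at h1
      exact h1.symm)
    (ξ := dChC (legendre L u₀) (legendre L u₀) ξ) (fun n => (hdC n ξ).symm.trans (hξ n))
  obtain ⟨X, f, hX, hf1, hf, h0, hXY⟩ := exists_lift hL u₀ hO hY (fun u hu hmem => by
    have hV : legendre L u ∈ V :=
      mem_of_chart_mem (s₀ := legendre L u₀) (s := legendre L u) hu (hOU hmem).2
    obtain ⟨ζ, hζ⟩ := (isInvertible_dChC (s₀ := legendre L u₀) (s := legendre L u) hu).surjective
      (Y (extChartAt (IC E) (legendre L u₀) (legendre L u)))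
    -- `Y` is tangent to the level sets at every point of `O`; at points of the image, tangency
    -- amounts to lying in the range of the pushforward.
    obtain ⟨η, rfl⟩ := (mem_range_dLegendre_iff hL hγ hV ζ).2 fun n => by
      have h1 := dC_eq_fderiv (s₀ := legendre L u₀) (s := legendre L u) hu
        (hγ.mdifferentiableAt n hV) ζ
      rw [hζ] at h1
      exact h1.trans (hYt _ hmem n)
    exact ⟨η, hζ⟩)
  refine ⟨X, (isProjectable_of_lift (fun s hs => (hf s hs).1) h0 hXY).mem_barT hL.smooth hX, ?_⟩
  apply (isInvertible_dChC (s₀ := legendre L u₀) (s := legendre L u₀) hs₀).injective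
  rw [hXY u₀ (by rw [hf1]; exact one_ne_zero), hY0, hf1, one_smul]

lemma mem_barKer_of_mem_barT {P : Field E Q} (hP : P ∈ barT L)
    (hker : ∀ u, P u ∈ kerOmegaAt L u) : P ∈ barKer L := by
  refine ⟨hP.1, hker, fun G hG u => ?_⟩
  have h1 : bracket G P u = -bracket P G u := VectorField.mlieBracket_swap_apply
  rw [h1, ContinuousLinearMap.map_neg, (hP.2 G hG).2.1 u, neg_zero]

/-- If `dim ker Ω_L = 2 N₀`, every combination of the differentials of the constraints is obtained
from a field in the reduced kernel of the Lagrange form. -/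
lemma exists_mem_barKer_canonicalForm_eq [T2Space Q] (hL : IsAlmostRegular L N₀)
    (hdim : ∀ u, Module.finrank ℝ (kerOmegaAt L u) = 2 * N₀)
    (hγ : IsPrimaryConstraints L V γ) {u₀ : PL E Q} (hu₀ : legendre L u₀ ∈ V)
    (c : Fin N₀ → ℝ) :
    ∃ P ∈ barKer L, ∀ η, canonicalForm (legendre L u₀) (dLegendre L u₀ (P u₀)) η =
      ∑ n, c n * dC (γ n) (legendre L u₀) η := by
  have hs₀ : (legendre L u₀).proj ∈ (chartAt E (legendre L u₀).proj).source :=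
    mem_chart_source E u₀.proj
  obtain ⟨Y, hY, hJ⟩ := exists_contDiffOn_hamiltonian (hγ.isOpen_chart (legendre L u₀))
    (hγ.contDiffOn_chart (legendre L u₀)) c
  have hform : ∀ s : PC E Q, s.proj ∈ (chartAt E (legendre L u₀).proj).source → s ∈ V →
      ∀ (a : ℝ) (ζ η : TangentSpace (IC E) s),
      dChC (legendre L u₀) s ζ = a • Y (extChartAt (IC E) (legendre L u₀) s) →
      canonicalForm s ζ η = a * ∑ n, c n * dC (γ n) s η := by
    intro s hs hV a ζ η h
    rw [canonicalForm_eq hs, h]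
    have h1 := hJ (extChartAt (IC E) (legendre L u₀) s) (dChC (legendre L u₀) s η)
    have h2 : ∀ n, dC (γ n) s η = _ := fun n => dC_eq_fderiv hs (hγ.mdifferentiableAt n hV) η
    simp only [h2, ← h1, Prod.smul_fst, Prod.smul_snd, ContinuousLinearMap.map_smul, smul_apply,
      smul_eq_mul]
    ring
  obtain ⟨X, f, hX, hf1, hf, h0, hXY⟩ := exists_lift hL u₀
    ((hγ.isOpen_chart (legendre L u₀)).mem_nhds (IsPrimaryConstraints.mem_chart hs₀ hu₀)) hY
    (fun u hu hmem => by
      have hV : legendre L u ∈ V :=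
        mem_of_chart_mem (s₀ := legendre L u₀) (s := legendre L u) hu hmem.2
      obtain ⟨ζ, hζ⟩ := (isInvertible_dChC (s₀ := legendre L u₀) (s := legendre L u)
        hu).surjective (Y (extChartAt (IC E) (legendre L u₀) (legendre L u)))
      -- The Hamiltonian vector `ζ` corresponds under `ω` to `∑ c_n dγ_n`, so the dimension
      -- hypothesis exhibits it as a pushforward; this is the tangency required for lifting.
      obtain ⟨η, -, rfl⟩ := exists_mem_kerOmegaAt hL hγ (hdim u) hV (ξ := ζ) (by
        have h1 : canonicalFlat (legendre L u) ζ =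
            ∑ n, c n • (dC (γ n) (legendre L u) : TangentSpace (IC E) (legendre L u) →ₗ[ℝ] ℝ) := by
          ext η
          have h2 := hform (legendre L u) hu hV 1 ζ η (by rw [hζ, one_smul])
          rw [one_mul] at h2
          rw [canonicalFlat_apply, h2, LinearMap.sum_apply]
          rfl
        rw [h1]
        exact Submodule.sum_mem _ fun n _ =>
          Submodule.smul_mem _ _ (Submodule.subset_span ⟨n, rfl⟩))
      exact ⟨η, hζ⟩)
  refine ⟨X, mem_barKer_of_mem_barT
    ((isProjectable_of_lift (fun s hs => (hf s hs).1) h0 hXY).mem_barT hL.smooth hX) ?_, ?_⟩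
  · intro u
    by_cases hu : f (legendre L u) = 0
    · rw [h0 u hu]
      exact zero_mem _
    · intro η
      obtain ⟨h1, h2⟩ := hf _ hu
      have hV := mem_of_chart_mem (s₀ := legendre L u₀) (s := legendre L u) h1 h2.2
      -- Pairing the lift with any vector gives a multiple of `∑ c_n dγ_n` on a pushforward, which
      -- vanishes; so the lift lies in `ker Ω_L` even after the cutoff.
      rw [omegaL_eq hL.smooth, hform (legendre L u) h1 hV _ _ _ (hXY u hu)]
      rw [Finset.sum_eq_zero fun n _ => by
        rw [dC_dLegendre_eq_zero hL.smooth hγ hV, mul_zero], mul_zero]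
  · intro η
    have h1 := hXY u₀ (by rw [hf1]; exact one_ne_zero)
    rw [hform _ hs₀ hu₀ _ _ η h1, hf1, one_mul]

lemma primFlat_eq_span [T2Space Q] (hL : IsAlmostRegular L N₀)
    (hdim : ∀ u, Module.finrank ℝ (kerOmegaAt L u) = 2 * N₀)
    (hγ : IsPrimaryConstraints L V γ) {u : PL E Q} (hu : legendre L u ∈ V) :
    primFlat L u = Submodule.span ℝ (range fun n => dC (γ n) (legendre L u)) := by
  ext σ
  constructor
  · rintro ⟨_, ⟨P, hP, rfl⟩, hσ⟩
    refine mem_span_iff_mem_dualSpan.2 ?_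
    have h1 : (σ : TangentSpace (IC E) (legendre L u) →ₗ[ℝ] ℝ) =
        canonicalFlat (legendre L u) (dLegendre L u (P u)) := LinearMap.ext hσ
    rw [h1]
    exact canonicalFlat_dLegendre_mem hL hγ hu (hP.2.1 u)
  · intro hσ
    obtain ⟨c, hc⟩ := (Submodule.mem_span_range_iff_exists_fun ℝ).1 hσ
    obtain ⟨P, hP, h⟩ := exists_mem_barKer_canonicalForm_eq hL hdim hγ hu c
    refine ⟨_, ⟨P, hP, rfl⟩, fun η => ?_⟩
    rw [h, ← hc, sum_apply]
    rfl

lemma dLegendre_eq_of_mk_eq (hL : ContMDiff (IL E) 𝓘(ℝ, ℝ) ∞ L) {X X' : barT L}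
    (h : (Submodule.Quotient.mk X : BarTQuot L) = Submodule.Quotient.mk X') (u : PL E Q) :
    dLegendre L u (X.1 u) = dLegendre L u (X'.1 u) := by
  have h1 : X.1 - X'.1 ∈ vertKer L :=
    (Submodule.Quotient.eq ((vertKer L).submoduleOf (barT L))).1 h
  have h2 := ((mem_vertKer_iff hL).1 h1).2 u
  have h3 : dLegendre L u (X.1 u - X'.1 u) = 0 := h2
  rwa [ContinuousLinearMap.map_sub, sub_eq_zero] at h3

lemma exists_pushClass_eq_singleton (hL : ContMDiff (IL E) 𝓘(ℝ, ℝ) ∞ L) (u : PL E Q)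
    (c : BarTQuot L) : ∃ ξ, pushClass L u c = {ξ} := by
  obtain ⟨X, rfl⟩ := Submodule.Quotient.mk_surjective _ c
  refine ⟨dLegendre L u (X.1 u), Subset.antisymm ?_ ?_⟩
  · rintro _ ⟨X', h, rfl⟩
    exact dLegendre_eq_of_mk_eq hL h u
  · rintro _ rfl
    exact ⟨X, rfl, rfl⟩

lemma iUnion_pushClass_eq [T2Space Q] (hL : IsAlmostRegular L N₀)
    (hγ : IsPrimaryConstraints L V γ) {u : PL E Q} (hu : legendre L u ∈ V) :
    (⋃ c : BarTQuot L, pushClass L u c) = primaryTangent γ (legendre L u) := by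
  ext ξ
  rw [mem_iUnion]
  constructor
  · rintro ⟨_, X, -, rfl⟩ n
    exact dC_dLegendre_eq_zero hL.smooth hγ hu n _
  · intro hξ
    obtain ⟨X, hX, rfl⟩ := exists_mem_barT_dLegendre_eq hL hγ hu hξ
    exact ⟨Submodule.Quotient.mk ⟨X, hX⟩, ⟨X, hX⟩, rfl, rfl⟩

/-- Integral curves of a field on `T^*Q` that extends the pushforward of a smooth field stay on
the primary constraint submanifold. -/
lemma eventually_mem_primarySubmanifold [T2Space Q] (hL : ContMDiff (IL E) 𝓘(ℝ, ℝ) ∞ L)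
    (hγ : IsPrimaryConstraints L V γ) {X : Field E Q} (hX : IsSmooth X) {u₀ : PL E Q}
    {Y : ∀ s : PC E Q, TangentSpace (IC E) s} (hu₀ : legendre L u₀ ∈ V)
    (hY : ContMDiffAt (IC E) (IC E).tangent 1
      (fun s => (⟨s, Y s⟩ : TangentBundle (IC E) (PC E Q))) (legendre L u₀))
    (hXY : ∀ᶠ u in 𝓝 u₀, Y (legendre L u) = dLegendre L u (X u)) {t₀ : ℝ} {s : ℝ → PC E Q}
    (hs₀ : s t₀ = legendre L u₀) (hs : IsMIntegralCurveAt (I := IC E) s Y t₀) :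
    ∀ᶠ t in 𝓝 t₀, s t ∈ primarySubmanifold V γ := by
  have : CompleteSpace (E × E) := FiniteDimensional.complete ℝ _
  have : CompleteSpace (E × (E →L[ℝ] ℝ)) := FiniteDimensional.complete ℝ _
  have : IsManifold (IC E) 1 (PC E Q) := IsManifold.of_le (n := ∞) (by simp)
  obtain ⟨c, rfl, hc⟩ := exists_isMIntegralCurveAt_of_contMDiffAt_boundaryless (I := IL E)
    (v := X) (x₀ := u₀) t₀ ((hX.of_le (m := 1) (by simp)) u₀)
  have hl := contMDiff_legendre hL
  -- The integral curve of `X` through `u₀` projects to an integral curve of `Y` lying in the image.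
  -- As `Y` is `C^1`, the given curve coincides with it near `t₀`.
  have hlc : IsMIntegralCurveAt (I := IC E) (legendre L ∘ c) Y t₀ := by
    filter_upwards [hc, hc.continuousAt.eventually hXY] with t ht htY
    have h1 := (hl.mdifferentiable (by simp) (c t)).hasMFDerivAt.comp t ht
    have h2 : (dLegendre L (c t)).comp ((1 : ℝ →L[ℝ] ℝ).smulRight (X (c t))) =
        (1 : ℝ →L[ℝ] ℝ).smulRight (Y (legendre L (c t))) := by
      refine ContinuousLinearMap.ext fun a => ?_
      have h3 : dLegendre L (c t) (a • X (c t)) = a • Y (legendre L (c t)) := by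
        rw [ContinuousLinearMap.map_smul, htY]
      exact h3
    exact h1.congr_mfderiv h2
  have heq := isMIntegralCurveAt_eventuallyEq_of_contMDiffAt_boundaryless (I := IC E)
    (by rw [hs₀]; exact hY) hs hlc hs₀
  filter_upwards [heq, hc.continuousAt.eventually (hl.continuous.continuousAt.eventually
    (hγ.isOpen.mem_nhds hu₀))] with t ht hV
  rw [ht]
  exact ⟨hV, fun n => hγ.vanish n _ ⟨mem_range_self _, hV⟩⟩

end SingularLagrangian

end

theorem mainTheorem10
    {E : Type*} [NormedAddCommGroup E] [NormedSpace ℝ E] [FiniteDimensional ℝ E]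
    {Q : Type*} [TopologicalSpace Q] [T2Space Q] [SigmaCompactSpace Q]
    [ChartedSpace E Q] [IsManifold 𝓘(ℝ, E) ∞ Q]
    (L : SingularLagrangian.PL E Q → ℝ) (N₀ : ℕ)
    (hL : SingularLagrangian.IsAlmostRegular L N₀) :
    -- the pushforward of a class is a single vector at each point
    (∀ (u : SingularLagrangian.PL E Q) (c : SingularLagrangian.BarTQuot L),
      ∃ ξ, SingularLagrangian.pushClass L u c = {ξ}) ∧
    -- primary constraints exist near every point of the image
    (∀ u : SingularLagrangian.PL E Q,
      ∃ (V : Set (SingularLagrangian.PC E Q)) (γ : Fin N₀ → SingularLagrangian.PC E Q → ℝ),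
        SingularLagrangian.legendre L u ∈ V ∧ SingularLagrangian.IsPrimaryConstraints L V γ) ∧
    -- for every choice of them, the pushforward is the tangent space
    (∀ (V : Set (SingularLagrangian.PC E Q)) (γ : Fin N₀ → SingularLagrangian.PC E Q → ℝ),
      SingularLagrangian.IsPrimaryConstraints L V γ →
      ∀ u : SingularLagrangian.PL E Q, SingularLagrangian.legendre L u ∈ V →
        (⋃ c : SingularLagrangian.BarTQuot L, SingularLagrangian.pushClass L u c) =
          SingularLagrangian.primaryTangent γ (SingularLagrangian.legendre L u)) ∧
    -- if `dim ker Ω_L = 2 N₀`, the primary constraints are first integrals of `Prim^♭ = 0`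
    ((∀ u : SingularLagrangian.PL E Q,
        Module.finrank ℝ (SingularLagrangian.kerOmegaAt L u) = 2 * N₀) →
      ∀ (V : Set (SingularLagrangian.PC E Q)) (γ : Fin N₀ → SingularLagrangian.PC E Q → ℝ),
        SingularLagrangian.IsPrimaryConstraints L V γ →
        ∀ u : SingularLagrangian.PL E Q, SingularLagrangian.legendre L u ∈ V →
          SingularLagrangian.primFlat L u =
            Submodule.span ℝ (Set.range
              (fun n => SingularLagrangian.dC (γ n) (SingularLagrangian.legendre L u)))) ∧
    -- projectable vector fields belong to `\overline{T P_L}`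
    (∀ X : SingularLagrangian.Field E Q, SingularLagrangian.IsSmooth X →
      SingularLagrangian.IsProjectable L X → X ∈ SingularLagrangian.barT L) ∧
    -- the pushforwards of the SOELVFs are tangent to `P_C^{[0]}` and their flows lie on it
    (∀ (V : Set (SingularLagrangian.PC E Q)) (γ : Fin N₀ → SingularLagrangian.PC E Q → ℝ),
      SingularLagrangian.IsPrimaryConstraints L V γ →
      ∀ X : SingularLagrangian.Field E Q, SingularLagrangian.IsSOELVF L X →
        (∀ u : SingularLagrangian.PL E Q, SingularLagrangian.legendre L u ∈ V →
          SingularLagrangian.dLegendre L u (X u) ∈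
            SingularLagrangian.primaryTangent γ (SingularLagrangian.legendre L u)) ∧
        (∀ (a b : ℝ) (c : ℝ → SingularLagrangian.PL E Q),
          IsMIntegralCurveOn (I := SingularLagrangian.IL E) c X (Set.Ioo a b) →
          ∀ t ∈ Set.Ioo a b, SingularLagrangian.legendre L (c t) ∈ V →
            SingularLagrangian.legendre L (c t) ∈ SingularLagrangian.primarySubmanifold V γ) ∧
        (∀ (u₀ : SingularLagrangian.PL E Q)
            (Y : ∀ s : SingularLagrangian.PC E Q, TangentSpace (SingularLagrangian.IC E) s),
          SingularLagrangian.legendre L u₀ ∈ V →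
          ContMDiffAt (SingularLagrangian.IC E) (SingularLagrangian.IC E).tangent 1
            (fun s => (⟨s, Y s⟩ : TangentBundle (SingularLagrangian.IC E)
              (SingularLagrangian.PC E Q))) (SingularLagrangian.legendre L u₀) →
          (∀ᶠ u in 𝓝 u₀, Y (SingularLagrangian.legendre L u) =
            SingularLagrangian.dLegendre L u (X u)) →
          ∀ (t₀ : ℝ) (s : ℝ → SingularLagrangian.PC E Q),
            s t₀ = SingularLagrangian.legendre L u₀ →
            IsMIntegralCurveAt (I := SingularLagrangian.IC E) s Y t₀ →
            ∀ᶠ t in 𝓝 t₀, s t ∈ SingularLagrangian.primarySubmanifold V γ)) := by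
  refine ⟨SingularLagrangian.exists_pushClass_eq_singleton hL.smooth,
    SingularLagrangian.exists_primaryConstraints hL,
    fun V γ hγ u hu => SingularLagrangian.iUnion_pushClass_eq hL hγ hu,
    fun hdim V γ hγ u hu => SingularLagrangian.primFlat_eq_span hL hdim hγ hu,
    fun X hXs hX => hX.mem_barT hL.smooth hXs, fun V γ hγ X hX => ⟨?_, ?_, ?_⟩⟩
  · exact fun u hu n => SingularLagrangian.dC_dLegendre_eq_zero hL.smooth hγ hu n (X u)
  · exact fun a b c _ t _ hV => ⟨hV, fun n => hγ.vanish n _ ⟨mem_range_self _, hV⟩⟩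
  · exact fun u₀ Y hu₀ hY hXY t₀ s hs₀ hs =>
      SingularLagrangian.eventually_mem_primarySubmanifold hL.smooth hγ hX.1 hu₀ hY hXY hs₀ hs
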